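/- Let $d \ge 1$, $\mathbb{T}^d = \mathbb{R}^d/\mathbb{Z}^d$, and let $S : \mathbb{R}^d \times \mathbb{R}^d \to \mathbb{R}$ be a generating function, that is, a map of class $C^2$ such that (i) $S(x+r, y+r) = S(x,y)$ for all $r \in \mathbb{Z}^d$ and all $x, y \in \mathbb{R}^d$; (ii) there is a real number $A > 0$ with $\sum_{i,j} \frac{\partial^2 S}{\partial x_i \partial y_j}(x,y)\, \xi_i \xi_j \le -A \|\xi\|^2$ for all $x, y, \xi \in \mathbb{R}^d$. Denote by $\partial_1 S(x,y), \partial_2 S(x,y) \in (\mathbb{R}^d)^*$ the partial differentials of $S$. Let $\overline{F}$ be the associated twist map of $T^*\mathbb{R}^d = \mathbb{R}^d \times (\mathbb{R}^d)^*$, implicitly defined by $$\overline{F}(x,p) = (x',p') \iff p = -\partial_1 S(x,x') \ \text{ and } \ p' = \partial_2 S(x,x'),$$ and let $F : T^*\mathbb{T}^d \to T^*\mathbb{T}^d$ be the map that it induces on $T^*\mathbb{T}^d = \mathbb{T}^d \times (\mathbb{R}^d)^*$. For $\omega \in T^*\mathbb{T}^d$ let $V(\omega) \subset T_\omega(T^*\mathbb{T}^d)$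 be the vertical space, i.e. the kernel of the differential at $\omega$ of the projection $T^*\mathbb{T}^d \to \mathbb{T}^d$. Assume that $F$ is without conjugate points: $$\forall \omega \in T^*\mathbb{T}^d, \ \forall n \in \mathbb{Z}\setminus\{0\}, \quad V(F^n(\omega)) \cap DF^n(\omega)\cdot V(\omega) = \{0\}.$$ A sequence $(x_n)_{n\in\mathbb{Z}}$ with values in $\mathbb{R}^d$ is called extremal if $\partial_2 S(x_{n-1},x_n) + \partial_1 S(x_n,x_{n+1}) = 0$ for all $n \in \mathbb{Z}$. **Proposition 2.1.** Let $r \in \mathbb{Z}^d$ and let $N \ge 1$ be an integer. If $(x_n)_{n\in\mathbb{Z}}$ is an extremal sequence such that $x_N = x_0 + r$, then $x_{n+N} = x_n + r$ for all $n \in \mathbb{Z}$. -/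

import Mathlib

noncomputable section

open scoped ContDiff Manifold

namespace TwistMap

/-! ### The torus and its cotangent bundle -/

/-- `ℝ^d` with its Euclidean norm. -/
abbrev Euc (d : ℕ) : Type := EuclideanSpace ℝ (Fin d)

/-- The dual space `(ℝ^d)^*`. -/
abbrev Dual (d : ℕ) : Type := Euc d →L[ℝ] ℝ

/-- An integer vector `r ∈ ℤ^d`, seen in `ℝ^d`. -/
def intVec {d : ℕ} : (Fin d → ℤ) →+ Euc d where
  toFun r := WithLp.toLp 2 (fun i => (r i : ℝ))
  map_zero' := by ext i; simp
  map_add' r s := by ext i; simp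

/-- The subgroup `ℤ^d` of `ℝ^d`. -/
def intLattice (d : ℕ) : AddSubgroup (Euc d) := (intVec (d := d)).range

/-- The torus `𝕋^d = ℝ^d / ℤ^d`. -/
abbrev Torus (d : ℕ) : Type := Euc d ⧸ intLattice d

theorem isDiscrete_intLattice (d : ℕ) : IsDiscrete (intLattice d : Set (Euc d)) := by
  rw [isDiscrete_iff_discreteTopology]
  apply DiscreteTopology.of_forall_le_dist (r := 1) one_pos
  rintro ⟨_, r, rfl⟩ ⟨_, s, rfl⟩ hne
  have hrs : ∃ i, r i ≠ s i := by
    by_contra! h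
    exact hne (by simp [funext h])
  obtain ⟨i, hi⟩ := hrs
  have h1 : (1 : ℝ) ≤ ‖(r i : ℝ) - s i‖ := by
    rw [Real.norm_eq_abs]
    exact_mod_cast Int.one_le_abs (sub_ne_zero.mpr hi)
  have h2 := PiLp.norm_apply_le (p := 2) (intVec r - intVec s : Euc d) i
  rw [Subtype.dist_eq, dist_eq_norm]
  exact h1.trans (by simpa [intVec] using h2)

theorem isLocalHomeomorph_mk (d : ℕ) :
    IsLocalHomeomorph (QuotientAddGroup.mk : Euc d → Torus d) :=
  ((intLattice d).isAddQuotientCoveringMap_of_comm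
    (isDiscrete_intLattice d)).isCoveringMap.isLocalHomeomorph

/-- The manifold structure of the torus: its charts are local inverses of the covering
`ℝ^d → 𝕋^d`. -/
instance instChartedSpaceTorus (d : ℕ) : ChartedSpace (Euc d) (Torus d) :=
  (isLocalHomeomorph_mk d).chartedSpace QuotientAddGroup.mk_surjective

/-- The cotangent bundle `T^*ℝ^d`, identified with `ℝ^d × (ℝ^d)^*`. -/
abbrev CotangentEuc (d : ℕ) : Type := Euc d × Dual d

/-- The cotangent bundle `T^*𝕋^d`, identified with `𝕋^d × (ℝ^d)^*`. -/
abbrev CotangentTorus (d : ℕ) : Type := Torus d × Dual d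

/-- The model with corners of `T^*𝕋^d`. -/
abbrev cotangentModel (d : ℕ) :
    ModelWithCorners ℝ (Euc d × Dual d) (ModelProd (Euc d) (Dual d)) :=
  𝓘(ℝ, Euc d).prod 𝓘(ℝ, Dual d)

/-- The covering `T^*ℝ^d → T^*𝕋^d`. -/
def coverProj {d : ℕ} (z : CotangentEuc d) : CotangentTorus d :=
  (QuotientAddGroup.mk z.1, z.2)

/-! ### Generating functions and extremal sequences -/

/-- The partial differential `∂₁S(x, y) ∈ (ℝ^d)^*`. -/
def d1 {d : ℕ} (S : Euc d × Euc d → ℝ) (x y : Euc d) : Dual d :=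
  fderiv ℝ (fun x' => S (x', y)) x

/-- The partial differential `∂₂S(x, y) ∈ (ℝ^d)^*`. -/
def d2 {d : ℕ} (S : Euc d × Euc d → ℝ) (x y : Euc d) : Dual d :=
  fderiv ℝ (fun y' => S (x, y')) y

/-- Generating functions: `C^2`, invariant under the diagonal action of `ℤ^d`, and subject to the
uniform twist condition `∑_{i,j} ∂²S/∂x_i∂y_j (x, y) ξ_i ξ_j ≤ -A ‖ξ‖²`. The sum is written as the
value at `(ξ, ξ)` of the bilinear form obtained by differentiating `∂₂S` with respect to `x`. -/
structure IsGeneratingFunction {d : ℕ} (S : Euc d × Euc d → ℝ) : Prop where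
  contDiff : ContDiff ℝ 2 S
  periodic : ∀ (r : Fin d → ℤ) (x y : Euc d), S (x + intVec r, y + intVec r) = S (x, y)
  twist : ∃ A : ℝ, 0 < A ∧ ∀ x y ξ : Euc d,
    fderiv ℝ (fun x' => d2 S x' y) x ξ ξ ≤ -A * ‖ξ‖ ^ 2

/-- Extremal sequences indexed by `ℤ`. -/
def IsExtremal {d : ℕ} (S : Euc d × Euc d → ℝ) (x : ℤ → Euc d) : Prop :=
  ∀ n : ℤ, d2 S (x (n - 1)) (x n) + d1 S (x n) (x (n + 1)) = 0

/-! ### The maps `y ↦ ∂₁S(x, y)` and `x ↦ ∂₂S(x, y)` are bijective -/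

theorem bijective_of_uniform {d : ℕ} {G : Euc d → Dual d} (hG : ContDiff ℝ 1 G) {A : ℝ}
    (hA : 0 < A) (h : ∀ y ξ : Euc d, fderiv ℝ G y ξ ξ ≤ -A * ‖ξ‖ ^ 2) :
    Function.Bijective G := by
  have hdiff : Differentiable ℝ G := hG.differentiable one_ne_zero
  have hmono : ∀ a b : Euc d, (G b - G a) (b - a) ≤ -A * ‖b - a‖ ^ 2 := by
    intro a b
    have hder : ∀ t : ℝ, HasDerivAt (fun t : ℝ => G (a + t • (b - a)) (b - a))
        (fderiv ℝ G (a + t • (b - a)) (b - a) (b - a)) t := by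
      intro t
      have h1 : HasDerivAt (fun t : ℝ => a + t • (b - a)) (b - a) t := by
        simpa using ((hasDerivAt_id t).smul_const (b - a)).const_add a
      have h2 := (hdiff (a + t • (b - a))).hasFDerivAt.comp_hasDerivAt t h1
      simpa using h2.clm_apply (hasDerivAt_const t (b - a))
    obtain ⟨c, -, hc⟩ := exists_hasDerivAt_eq_slope _ _ (zero_lt_one (α := ℝ))
      (fun t _ => (hder t).continuousAt.continuousWithinAt) (fun t _ => hder t)
    have := h (a + c • (b - a)) (b - a)
    rw [hc] at this
    simpa using this
  have hanti : AntilipschitzWith (Real.toNNReal A⁻¹) G := by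
    apply AntilipschitzWith.of_le_mul_dist
    intro a b
    rw [Real.coe_toNNReal _ (inv_pos.mpr hA).le, dist_eq_norm, dist_eq_norm,
      norm_sub_rev a b, norm_sub_rev (G a) (G b), inv_mul_eq_div, le_div_iff₀ hA]
    have h1 := hmono a b
    have h2 := (neg_le_abs ((G b - G a) (b - a))).trans ((G b - G a).le_opNorm (b - a))
    rcases (norm_nonneg (b - a)).eq_or_lt with h0 | h0
    · rw [← h0]; simp
    · nlinarith
  have hclosed : IsClosed (Set.range G) := by
    have hp : IsProperMap G := by
      rw [isProperMap_iff_tendsto_cocompact]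
      refine ⟨hG.continuous, ?_⟩
      have := hanti.tendsto_cobounded
      rwa [Metric.cobounded_eq_cocompact, Metric.cobounded_eq_cocompact] at this
    exact hp.isClosedMap.isClosed_range
  have hopen : IsOpen (Set.range G) := by
    rw [isOpen_iff_mem_nhds]
    rintro _ ⟨y, rfl⟩
    have hs : HasStrictFDerivAt G (fderiv ℝ G y) y := hG.contDiffAt.hasStrictFDerivAt one_ne_zero
    have hinj : Function.Injective (fderiv ℝ G y) := by
      rw [injective_iff_map_eq_zero]
      intro ξ hξ
      have := h y ξ
      rw [hξ] at this
      by_contra hne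
      have : 0 < ‖ξ‖ ^ 2 := by positivity
      simp at *
      nlinarith
    have hsurj : Function.Surjective (fderiv ℝ G y) := by
      let T := (InnerProductSpace.toDual ℝ (Euc d)).symm.toLinearEquiv
      have h3 : Function.Injective (T.toLinearMap.comp (fderiv ℝ G y).toLinearMap) :=
        T.injective.comp hinj
      have h4 := LinearMap.injective_iff_surjective.mp h3
      intro p
      obtain ⟨ξ, hξ⟩ := h4 (T p)
      exact ⟨ξ, T.injective hξ⟩
    have := hs.map_nhds_eq_of_surj (LinearMap.range_eq_top.mpr hsurj)
    rw [← this]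
    exact Filter.mem_map.mpr (Filter.univ_mem' fun z => ⟨z, rfl⟩)
  exact ⟨hanti.injective, Set.range_eq_univ.mp
    (IsClopen.eq_univ ⟨hclosed, hopen⟩ (Set.range_nonempty G))⟩

namespace IsGeneratingFunction

variable {d : ℕ} {S : Euc d × Euc d → ℝ}

theorem d1_eq (hS : IsGeneratingFunction S) (x y : Euc d) :
    d1 S x y = (fderiv ℝ S (x, y)).comp (ContinuousLinearMap.inl ℝ (Euc d) (Euc d)) :=
  ((hS.contDiff.differentiable two_ne_zero (x, y)).hasFDerivAt.comp x
    (hasFDerivAt_prodMk_left x y)).fderiv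

theorem d2_eq (hS : IsGeneratingFunction S) (x y : Euc d) :
    d2 S x y = (fderiv ℝ S (x, y)).comp (ContinuousLinearMap.inr ℝ (Euc d) (Euc d)) :=
  ((hS.contDiff.differentiable two_ne_zero (x, y)).hasFDerivAt.comp y
    (hasFDerivAt_prodMk_right x y)).fderiv

theorem contDiff_fderiv (hS : IsGeneratingFunction S) : ContDiff ℝ 1 (fderiv ℝ S) :=
  hS.contDiff.fderiv_right (by norm_num)

theorem contDiff_d1 (hS : IsGeneratingFunction S) (x : Euc d) : ContDiff ℝ 1 (d1 S x) := by
  rw [show d1 S x = fun y => _ from funext (hS.d1_eq x)]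
  exact (hS.contDiff_fderiv.comp (by fun_prop)).clm_comp contDiff_const

theorem contDiff_d2 (hS : IsGeneratingFunction S) (y : Euc d) :
    ContDiff ℝ 1 (fun x => d2 S x y) := by
  simp only [hS.d2_eq]
  exact (hS.contDiff_fderiv.comp (by fun_prop)).clm_comp contDiff_const

/-- The mixed second derivatives of `S` do not depend on the order of differentiation. -/
theorem fderiv_d1 (hS : IsGeneratingFunction S) (x y ξ η : Euc d) :
    fderiv ℝ (d1 S x) y η ξ = fderiv ℝ (fun x' => d2 S x' y) x ξ η := by
  have hD : HasFDerivAt (fderiv ℝ S) (fderiv ℝ (fderiv ℝ S) (x, y)) (x, y) :=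
    (hS.contDiff_fderiv.differentiable one_ne_zero (x, y)).hasFDerivAt
  have e1 : fderiv ℝ (d1 S x) y η ξ = fderiv ℝ (fderiv ℝ S) (x, y) (0, η) (ξ, 0) := by
    let P := (ContinuousLinearMap.compL ℝ (Euc d) (Euc d × Euc d) ℝ).flip
      (ContinuousLinearMap.inl ℝ (Euc d) (Euc d))
    have h : HasFDerivAt (fun y' => P (fderiv ℝ S (x, y'))) _ y :=
      P.hasFDerivAt.comp y (hD.comp y (hasFDerivAt_prodMk_right x y))
    have h' : d1 S x = fun y' => P (fderiv ℝ S (x, y')) := funext (hS.d1_eq x)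
    rw [h', h.fderiv]
    rfl
  have e2 : fderiv ℝ (fun x' => d2 S x' y) x ξ η =
      fderiv ℝ (fderiv ℝ S) (x, y) (ξ, 0) (0, η) := by
    let P := (ContinuousLinearMap.compL ℝ (Euc d) (Euc d × Euc d) ℝ).flip
      (ContinuousLinearMap.inr ℝ (Euc d) (Euc d))
    have h : HasFDerivAt (fun x' => P (fderiv ℝ S (x', y))) _ x :=
      P.hasFDerivAt.comp x (hD.comp x (hasFDerivAt_prodMk_left x y))
    have h' : (fun x' => d2 S x' y) = fun x' => P (fderiv ℝ S (x', y)) :=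
      funext fun x' => hS.d2_eq x' y
    rw [h', h.fderiv]
    rfl
  have hsymm : IsSymmSndFDerivAt ℝ S (x, y) :=
    hS.contDiff.contDiffAt.isSymmSndFDerivAt (by simp)
  rw [e1, e2]
  exact hsymm.eq (0, η) (ξ, 0)

theorem bijective_d1 (hS : IsGeneratingFunction S) (x : Euc d) :
    Function.Bijective (fun y => -d1 S x y) := by
  obtain ⟨A, hA, h⟩ := hS.twist
  have : Function.Bijective (d1 S x) :=
    bijective_of_uniform (hS.contDiff_d1 x) hA fun y ξ => by rw [hS.fderiv_d1]; exact h x y ξ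
  exact neg_involutive.bijective.comp this

theorem bijective_d2 (hS : IsGeneratingFunction S) (y : Euc d) :
    Function.Bijective (fun x => d2 S x y) := by
  obtain ⟨A, hA, h⟩ := hS.twist
  exact bijective_of_uniform (hS.contDiff_d2 y) hA fun x ξ => h x y ξ

/-! ### The twist map -/

/-- The unique `x'` with `p = -∂₁S(x, x')`. -/
def next (hS : IsGeneratingFunction S) (x : Euc d) (p : Dual d) : Euc d :=
  (Equiv.ofBijective _ (hS.bijective_d1 x)).symm p

/-- The unique `x` with `p' = ∂₂S(x, x')`. -/
def prev (hS : IsGeneratingFunction S) (x' : Euc d) (p' : Dual d) : Euc d :=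
  (Equiv.ofBijective _ (hS.bijective_d2 x')).symm p'

theorem next_eq_iff (hS : IsGeneratingFunction S) (x x' : Euc d) (p : Dual d) :
    hS.next x p = x' ↔ p = -d1 S x x' := by
  rw [next, Equiv.symm_apply_eq]; rfl

theorem prev_eq_iff (hS : IsGeneratingFunction S) (x x' : Euc d) (p' : Dual d) :
    hS.prev x' p' = x ↔ p' = d2 S x x' := by
  rw [prev, Equiv.symm_apply_eq]; rfl

/-- The lifted twist map `F̄ : T^*ℝ^d → T^*ℝ^d`, defined implicitly by
`F̄(x, p) = (x', p') ↔ p = -∂₁S(x, x') ∧ p' = ∂₂S(x, x')`. -/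
def twistLift (hS : IsGeneratingFunction S) : Equiv.Perm (CotangentEuc d) where
  toFun z := (hS.next z.1 z.2, d2 S z.1 (hS.next z.1 z.2))
  invFun z := (hS.prev z.1 z.2, -d1 S (hS.prev z.1 z.2) z.1)
  left_inv z := by
    have h : hS.prev (hS.next z.1 z.2) (d2 S z.1 (hS.next z.1 z.2)) = z.1 :=
      (hS.prev_eq_iff _ _ _).mpr rfl
    simp only [h]
    exact Prod.ext rfl ((hS.next_eq_iff _ _ _).mp rfl).symm
  right_inv z := by
    have h : hS.next (hS.prev z.1 z.2) (-d1 S (hS.prev z.1 z.2) z.1) = z.1 :=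
      (hS.next_eq_iff _ _ _).mpr rfl
    simp only [h]
    exact Prod.ext rfl ((hS.prev_eq_iff _ _ _).mp rfl).symm

theorem twistLift_eq_iff (hS : IsGeneratingFunction S) (x x' : Euc d) (p p' : Dual d) :
    hS.twistLift (x, p) = (x', p') ↔ p = -d1 S x x' ∧ p' = d2 S x x' := by
  change (hS.next x p, d2 S x (hS.next x p)) = (x', p') ↔ _
  rw [Prod.mk.injEq, ← hS.next_eq_iff]
  constructor
  · rintro ⟨rfl, rfl⟩; exact ⟨rfl, rfl⟩
  · rintro ⟨rfl, rfl⟩; exact ⟨rfl, rfl⟩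

theorem d1_add (hS : IsGeneratingFunction S) (r : Fin d → ℤ) (x y : Euc d) :
    d1 S (x + intVec r) (y + intVec r) = d1 S x y := by
  unfold d1
  rw [← fderiv_comp_add_right (f := fun x' => S (x', y + intVec r))]
  simp only [hS.periodic]

theorem d2_add (hS : IsGeneratingFunction S) (r : Fin d → ℤ) (x y : Euc d) :
    d2 S (x + intVec r) (y + intVec r) = d2 S x y := by
  unfold d2
  rw [← fderiv_comp_add_right (f := fun y' => S (x + intVec r, y'))]
  simp only [hS.periodic]

theorem twistLift_add (hS : IsGeneratingFunction S) (r : Fin d → ℤ) (z : CotangentEuc d) :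
    hS.twistLift (z + (intVec r, 0)) = hS.twistLift z + (intVec r, 0) := by
  obtain ⟨x, p⟩ := z
  obtain ⟨⟨x', p'⟩, hz⟩ : ∃ z', hS.twistLift (x, p) = z' := ⟨_, rfl⟩
  rw [hz]
  rw [twistLift_eq_iff] at hz
  simp only [Prod.mk_add_mk, add_zero]
  rw [hS.twistLift_eq_iff, hS.d1_add, hS.d2_add]
  exact hz

theorem twistLift_symm_add (hS : IsGeneratingFunction S) (r : Fin d → ℤ) (z : CotangentEuc d) :
    hS.twistLift.symm (z + (intVec r, 0)) = hS.twistLift.symm z + (intVec r, 0) := by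
  rw [Equiv.symm_apply_eq, twistLift_add, Equiv.apply_symm_apply]

end IsGeneratingFunction

/-- A self-map of `T^*ℝ^d` that commutes with the translations by `ℤ^d` descends to `T^*𝕋^d`. -/
def descend {d : ℕ} (f : CotangentEuc d → CotangentEuc d)
    (hf : ∀ (r : Fin d → ℤ) (z : CotangentEuc d), f (z + (intVec r, 0)) = f z + (intVec r, 0))
    (w : CotangentTorus d) : CotangentTorus d :=
  Quotient.liftOn' w.1 (fun x => coverProj (f (x, w.2))) (by
    intro x y hxy
    rw [QuotientAddGroup.leftRel_apply] at hxy
    obtain ⟨r, hr⟩ := hxy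
    have hy : ((y, w.2) : CotangentEuc d) = (x, w.2) + (intVec r, 0) := by
      rw [hr]; simp
    simp only [hy, hf]
    refine Prod.ext ?_ (by simp [coverProj])
    simp only [coverProj, Prod.fst_add]
    exact (QuotientAddGroup.mk_add_of_mem _ (show intVec r ∈ intLattice d from ⟨r, rfl⟩)).symm)

theorem descend_coverProj {d : ℕ} (f : CotangentEuc d → CotangentEuc d)
    (hf : ∀ (r : Fin d → ℤ) (z : CotangentEuc d), f (z + (intVec r, 0)) = f z + (intVec r, 0))
    (z : CotangentEuc d) : descend f hf (coverProj z) = coverProj (f z) := rfl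

theorem coverProj_surjective {d : ℕ} : Function.Surjective (coverProj (d := d)) := by
  rintro ⟨q, p⟩
  obtain ⟨x, rfl⟩ := QuotientAddGroup.mk_surjective q
  exact ⟨(x, p), rfl⟩

/-- The twist map `F : T^*𝕋^d → T^*𝕋^d` with generating function `S`, as a bijection: it is induced
by `F̄` on the quotient. -/
def IsGeneratingFunction.twistMap {d : ℕ} {S : Euc d × Euc d → ℝ}
    (hS : IsGeneratingFunction S) : Equiv.Perm (CotangentTorus d) where
  toFun := descend hS.twistLift hS.twistLift_add
  invFun := descend hS.twistLift.symm hS.twistLift_symm_add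
  left_inv w := by
    obtain ⟨z, rfl⟩ := coverProj_surjective w
    simp only [descend_coverProj, Equiv.symm_apply_apply]
  right_inv w := by
    obtain ⟨z, rfl⟩ := coverProj_surjective w
    simp only [descend_coverProj, Equiv.apply_symm_apply]

/-! ### Conjugate points -/

/-- The vertical space `V(w)`: the kernel of the differential at `w` of the projection
`π : T^*𝕋^d → 𝕋^d`. -/
def verticalSpace {d : ℕ} (w : CotangentTorus d) :
    Submodule ℝ (TangentSpace (cotangentModel d) w) :=
  LinearMap.ker (mfderiv (cotangentModel d) 𝓘(ℝ, Euc d)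
    (Prod.fst : CotangentTorus d → Torus d) w).toLinearMap

/-- `F` is without conjugate points: `V(F^n(w)) ∩ DF^n(w) · V(w) = {0}` for all `w ∈ T^*𝕋^d` and
all integers `n ≠ 0`. -/
def IsGeneratingFunction.NoConjugatePoints {d : ℕ} {S : Euc d × Euc d → ℝ}
    (hS : IsGeneratingFunction S) : Prop :=
  ∀ (w : CotangentTorus d) (n : ℤ), n ≠ 0 →
    verticalSpace ((hS.twistMap ^ n) w) ⊓
      (verticalSpace w).map (mfderiv (cotangentModel d) (cotangentModel d)
        (hS.twistMap ^ n : Equiv.Perm (CotangentTorus d)) w).toLinearMap = ⊥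

end TwistMap

end

noncomputable section

open scoped ContDiff Manifold Topology

open Filter

/-! ### Bijections of class `C^1` between finite-dimensional spaces -/

/-! Extremal sequences are the projections of orbits of the lifted twist map. Fix the two endpoints
of a segment. The kernel of the second variation of the action along an orbit segment consists of
the Jacobi fields vanishing at both ends, that is, of the vertical vectors that the iterated
differential sends to vertical vectors. Absence of conjugate points says that there are none but
zero, so the second variation is nondegenerate along every orbit segment
(`eq_zero_of_secondVariation_eq_zero`).

The twist condition makes the action coercive, so minimizers exist, and the second variation is
nonnegative there. A nonnegative nondegenerate form is positive definite, hence positivity is an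
open and closed condition on the initial point in the connected space `T^*ℝ^d`: it holds along all
orbits (`secondVariation_orbit_pos`). Every critical point of the action is then a nondegenerate
minimum, and a coercive function with this property has at most one critical point, since the basins
of attraction of gradient descent are open, disjoint and cover a connected ball
(`eq_of_gradient_eq_zero`). Consequently two arbitrary endpoints are joined by exactly one orbit
segment of given length `n ≥ 1`, and it minimizes the action (`bijective_endpoints`,
`action_orbit_le`).

Now let `f a` be the action of the orbit segment of length `N` from `a` to `a + r`. Its differential
is `p_N - p_0`, so its critical points are the segments that close up to the translation by `r` in
`T^*ℝ^d`, not only in `ℝ^d`. The function `f` is `ℤ^d`-periodic, so it has a maximum and a minimum,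
both critical. Two orbits that close up in this way have the same action: over a long time each can
be compared with the other, with the ends modified, at a cost that does not depend on the time
(`action_le_of_periodic`). Therefore `f` is constant, every `a` is critical, and the given segment
closes up (`twistLift_pow_eq_add`). -/

theorem contDiff_symm_of_injective_fderiv {X Y : Type*} [NormedAddCommGroup X] [NormedSpace ℝ X]
    [FiniteDimensional ℝ X] [NormedAddCommGroup Y] [NormedSpace ℝ Y] [FiniteDimensional ℝ Y]
    (hdim : Module.finrank ℝ X = Module.finrank ℝ Y) (e : X ≃ Y) (he : ContDiff ℝ 1 e)
    (hinj : ∀ x, Function.Injective (fderiv ℝ e x)) : ContDiff ℝ 1 e.symm := by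
  have : CompleteSpace X := FiniteDimensional.complete ℝ X
  have : CompleteSpace Y := FiniteDimensional.complete ℝ Y
  let e' : X → X ≃L[ℝ] Y := fun x =>
    (LinearEquiv.ofInjectiveOfFinrankEq (fderiv ℝ e x).toLinearMap (hinj x)
      hdim).toContinuousLinearEquiv
  have hee : ∀ x, (e' x : X →L[ℝ] Y) = fderiv ℝ e x := fun x => by ext v; rfl
  have hstrict : ∀ x, HasStrictFDerivAt e (e' x : X →L[ℝ] Y) x := fun x => by
    rw [hee]; exact he.contDiffAt.hasStrictFDerivAt one_ne_zero
  -- By the inverse function theorem `e` is open, so the inverse bijection is continuous.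
  have hopen : IsOpenMap e := isOpenMap_iff_nhds_le.mpr fun x =>
    ((hstrict x).map_nhds_eq_of_equiv).ge
  let h : X ≃ₜ Y := e.toHomeomorphOfContinuousOpen he.continuous hopen
  exact h.contDiff_symm (f₀' := e') (fun x => (hstrict x).hasFDerivAt) he

namespace TwistMap

variable {d : ℕ} {S : Euc d × Euc d → ℝ}

theorem finrank_dual (d : ℕ) : Module.finrank ℝ (Dual d) = Module.finrank ℝ (Euc d) :=
  ((InnerProductSpace.toDual ℝ (Euc d)).toLinearEquiv.finrank_eq).symm

namespace IsGeneratingFunction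

/-! ### Smoothness of the twist map -/

theorem contDiff_d1_uncurry (hS : IsGeneratingFunction S) :
    ContDiff ℝ 1 (fun q : Euc d × Euc d => d1 S q.1 q.2) := by
  simp only [hS.d1_eq]
  exact hS.contDiff_fderiv.clm_comp contDiff_const

theorem contDiff_d2_uncurry (hS : IsGeneratingFunction S) :
    ContDiff ℝ 1 (fun q : Euc d × Euc d => d2 S q.1 q.2) := by
  simp only [hS.d2_eq]
  exact hS.contDiff_fderiv.clm_comp contDiff_const

theorem hasFDerivAt_fderiv (hS : IsGeneratingFunction S) (q : Euc d × Euc d) :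
    HasFDerivAt (fderiv ℝ S) (fderiv ℝ (fderiv ℝ S) q) q :=
  (hS.contDiff_fderiv.differentiable one_ne_zero q).hasFDerivAt

theorem fderiv_d1_uncurry_apply (hS : IsGeneratingFunction S) (q v : Euc d × Euc d) (ξ : Euc d) :
    fderiv ℝ (fun q : Euc d × Euc d => d1 S q.1 q.2) q v ξ =
      fderiv ℝ (fderiv ℝ S) q v (ξ, 0) := by
  let P := (ContinuousLinearMap.compL ℝ (Euc d) (Euc d × Euc d) ℝ).flip
    (ContinuousLinearMap.inl ℝ (Euc d) (Euc d))
  have h : HasFDerivAt (fun q => P (fderiv ℝ S q)) _ q :=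
    P.hasFDerivAt.comp q (hS.hasFDerivAt_fderiv q)
  have h' : (fun q : Euc d × Euc d => d1 S q.1 q.2) = fun q => P (fderiv ℝ S q) :=
    funext fun q => hS.d1_eq q.1 q.2
  rw [h', h.fderiv]
  rfl

theorem fderiv_d2_uncurry_apply (hS : IsGeneratingFunction S) (q v : Euc d × Euc d) (ξ : Euc d) :
    fderiv ℝ (fun q : Euc d × Euc d => d2 S q.1 q.2) q v ξ =
      fderiv ℝ (fderiv ℝ S) q v (0, ξ) := by
  let P := (ContinuousLinearMap.compL ℝ (Euc d) (Euc d × Euc d) ℝ).flip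
    (ContinuousLinearMap.inr ℝ (Euc d) (Euc d))
  have h : HasFDerivAt (fun q => P (fderiv ℝ S q)) _ q :=
    P.hasFDerivAt.comp q (hS.hasFDerivAt_fderiv q)
  have h' : (fun q : Euc d × Euc d => d2 S q.1 q.2) = fun q => P (fderiv ℝ S q) :=
    funext fun q => hS.d2_eq q.1 q.2
  rw [h', h.fderiv]
  rfl

theorem fderiv_fderiv_symm (hS : IsGeneratingFunction S) (q v w : Euc d × Euc d) :
    fderiv ℝ (fderiv ℝ S) q v w = fderiv ℝ (fderiv ℝ S) q w v :=
  (hS.contDiff.contDiffAt.isSymmSndFDerivAt (by simp)).eq v w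

theorem twist_fst (hS : IsGeneratingFunction S) :
    ∃ A : ℝ, 0 < A ∧ ∀ (q : Euc d × Euc d) (ξ : Euc d),
      fderiv ℝ (fderiv ℝ S) q (ξ, 0) (0, ξ) ≤ -A * ‖ξ‖ ^ 2 := by
  obtain ⟨A, hA, h⟩ := hS.twist
  refine ⟨A, hA, fun q ξ => (le_of_eq ?_).trans (h q.1 q.2 ξ)⟩
  rw [← hS.fderiv_d2_uncurry_apply]
  have h1 : HasFDerivAt (fun x => d2 S x q.2) _ q.1 :=
    HasFDerivAt.comp (g := fun q : Euc d × Euc d => d2 S q.1 q.2) q.1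
      (hS.contDiff_d2_uncurry.differentiable one_ne_zero q).hasFDerivAt
      (hasFDerivAt_prodMk_left (𝕜 := ℝ) q.1 q.2)
  rw [h1.fderiv]
  rfl

/-- A vector on which the mixed second derivative vanishes identically is zero. -/
theorem eq_zero_of_fderiv_fderiv_inl (hS : IsGeneratingFunction S) {q : Euc d × Euc d} {ξ : Euc d}
    (h : fderiv ℝ (fderiv ℝ S) q (ξ, 0) (0, ξ) = 0) : ξ = 0 := by
  obtain ⟨A, hA, ht⟩ := hS.twist_fst
  have h1 := ht q ξ
  rw [h] at h1
  by_contra hne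
  have : 0 < ‖ξ‖ ^ 2 := by positivity
  nlinarith

theorem eq_zero_of_fderiv_fderiv_inr (hS : IsGeneratingFunction S) {q : Euc d × Euc d} {ξ : Euc d}
    (h : fderiv ℝ (fderiv ℝ S) q (0, ξ) (ξ, 0) = 0) : ξ = 0 :=
  hS.eq_zero_of_fderiv_fderiv_inl (by rw [hS.fderiv_fderiv_symm]; exact h)

/-- Pairs of consecutive points parametrize `T^*ℝ^d`, through `(x, x') ↦ (x, -∂₁S(x, x'))`. -/
def ofPair (hS : IsGeneratingFunction S) : Euc d × Euc d ≃ CotangentEuc d where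
  toFun q := (q.1, -d1 S q.1 q.2)
  invFun z := (z.1, hS.next z.1 z.2)
  left_inv _ := Prod.ext rfl ((hS.next_eq_iff _ _ _).mpr rfl)
  right_inv _ := Prod.ext rfl ((hS.next_eq_iff _ _ _).mp rfl).symm

theorem contDiff_ofPair (hS : IsGeneratingFunction S) : ContDiff ℝ 1 hS.ofPair :=
  contDiff_fst.prodMk hS.contDiff_d1_uncurry.neg

theorem fderiv_ofPair (hS : IsGeneratingFunction S) (q v : Euc d × Euc d) :
    fderiv ℝ hS.ofPair q v =
      (v.1, -fderiv ℝ (fun q : Euc d × Euc d => d1 S q.1 q.2) q v) := by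
  have h : HasFDerivAt hS.ofPair _ q := hasFDerivAt_fst.prodMk
    (hS.contDiff_d1_uncurry.differentiable one_ne_zero q).hasFDerivAt.neg
  rw [h.fderiv]; rfl

/-- A kernel vector of the differential has the form `(0, η)` with `∂₂∂₁S · η = 0`; testing this on
`η` itself contradicts the twist condition unless `η = 0`. -/
theorem contDiff_ofPair_symm (hS : IsGeneratingFunction S) : ContDiff ℝ 1 hS.ofPair.symm := by
  refine contDiff_symm_of_injective_fderiv (by simp [finrank_dual]) _ hS.contDiff_ofPair fun q => ?_
  rw [injective_iff_map_eq_zero]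
  rintro ⟨ξ, η⟩ h
  rw [hS.fderiv_ofPair, Prod.mk_eq_zero, neg_eq_zero] at h
  obtain ⟨rfl, h⟩ := h
  rw [hS.eq_zero_of_fderiv_fderiv_inr (q := q) (ξ := η) (by
    rw [← hS.fderiv_d1_uncurry_apply, h]; rfl)]
  rfl

theorem twistLift_ofPair (hS : IsGeneratingFunction S) (q : Euc d × Euc d) :
    hS.twistLift (hS.ofPair q) = (q.2, d2 S q.1 q.2) :=
  (hS.twistLift_eq_iff _ _ _ _).mpr ⟨rfl, rfl⟩

theorem contDiff_twistLift (hS : IsGeneratingFunction S) : ContDiff ℝ 1 hS.twistLift := by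
  have h : ⇑hS.twistLift = (fun q : Euc d × Euc d => (q.2, d2 S q.1 q.2)) ∘ hS.ofPair.symm := by
    funext z
    rw [Function.comp_apply, ← hS.twistLift_ofPair, Equiv.apply_symm_apply]
  rw [h]
  exact (contDiff_snd.prodMk hS.contDiff_d2_uncurry).comp hS.contDiff_ofPair_symm

theorem contDiff_twistLift_pow (hS : IsGeneratingFunction S) (n : ℕ) :
    ContDiff ℝ 1 (hS.twistLift ^ n : Equiv.Perm (CotangentEuc d)) := by
  induction n with
  | zero => exact contDiff_id
  | succ n ih =>
    rw [pow_succ']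
    exact hS.contDiff_twistLift.comp ih

/-- In the coordinates `(x, x')` the differential of the twist map involves only second derivatives
of `S`, with no inverse of the mixed derivative. This is the link with the second variation of the
action. -/
theorem fderiv_twistLift_ofPair (hS : IsGeneratingFunction S) (q v : Euc d × Euc d) :
    fderiv ℝ hS.twistLift (hS.ofPair q) (fderiv ℝ hS.ofPair q v) =
      (v.2, fderiv ℝ (fun q : Euc d × Euc d => d2 S q.1 q.2) q v) := by
  have h1 : HasFDerivAt (hS.twistLift ∘ hS.ofPair) _ q :=
    (hS.contDiff_twistLift.differentiable one_ne_zero _).hasFDerivAt.comp q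
      (hS.contDiff_ofPair.differentiable one_ne_zero q).hasFDerivAt
  have h2 : HasFDerivAt (fun q : Euc d × Euc d => (q.2, d2 S q.1 q.2)) _ q :=
    hasFDerivAt_snd.prodMk (hS.contDiff_d2_uncurry.differentiable one_ne_zero q).hasFDerivAt
  rw [show hS.twistLift ∘ hS.ofPair = _ from funext hS.twistLift_ofPair] at h1
  exact DFunLike.congr_fun (h1.unique h2) v

theorem fderiv_twistLift_pow_succ (hS : IsGeneratingFunction S) (n : ℕ) (z ζ : CotangentEuc d) :
    fderiv ℝ (hS.twistLift ^ (n + 1) : Equiv.Perm (CotangentEuc d)) z ζ =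
      fderiv ℝ hS.twistLift ((hS.twistLift ^ n) z)
        (fderiv ℝ (hS.twistLift ^ n : Equiv.Perm (CotangentEuc d)) z ζ) := by
  have h : HasFDerivAt (hS.twistLift ∘ (hS.twistLift ^ n : Equiv.Perm (CotangentEuc d))) _ z :=
    (hS.contDiff_twistLift.differentiable one_ne_zero _).hasFDerivAt.comp z
      ((hS.contDiff_twistLift_pow n).differentiable one_ne_zero z).hasFDerivAt
  rw [pow_succ', Equiv.Perm.coe_mul, h.fderiv]
  rfl

theorem surjective_fderiv_ofPair (hS : IsGeneratingFunction S) (q : Euc d × Euc d) :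
    Function.Surjective (fderiv ℝ hS.ofPair q) := by
  have h1 := (hS.contDiff_ofPair.differentiable one_ne_zero _).hasFDerivAt.comp (hS.ofPair q)
    (hS.contDiff_ofPair_symm.differentiable one_ne_zero _).hasFDerivAt
  rw [Equiv.symm_apply_apply, Equiv.self_comp_symm] at h1
  exact fun v => ⟨_, DFunLike.congr_fun (h1.unique (hasFDerivAt_id _)) v⟩

theorem injective_fderiv_twistLift (hS : IsGeneratingFunction S) (z : CotangentEuc d) :
    Function.Injective (fderiv ℝ hS.twistLift z) := by
  obtain ⟨q, rfl⟩ := hS.ofPair.surjective z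
  rw [injective_iff_map_eq_zero]
  intro ζ hζ
  obtain ⟨⟨ξ, η⟩, rfl⟩ := hS.surjective_fderiv_ofPair q ζ
  rw [hS.fderiv_twistLift_ofPair, Prod.mk_eq_zero] at hζ
  obtain ⟨rfl, h⟩ := hζ
  rw [hS.eq_zero_of_fderiv_fderiv_inl (q := q) (ξ := ξ) (by
    rw [← hS.fderiv_d2_uncurry_apply, h]; rfl)]
  exact map_zero _

theorem injective_fderiv_twistLift_pow (hS : IsGeneratingFunction S) (n : ℕ)
    (z : CotangentEuc d) :
    Function.Injective (fderiv ℝ (hS.twistLift ^ n : Equiv.Perm (CotangentEuc d)) z) := by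
  induction n with
  | zero =>
    rw [pow_zero, Equiv.Perm.coe_one, fderiv_id]
    exact Function.injective_id
  | succ n ih =>
    intro ζ ζ' h
    rw [hS.fderiv_twistLift_pow_succ, hS.fderiv_twistLift_pow_succ] at h
    exact ih (hS.injective_fderiv_twistLift _ h)

theorem twistLift_pow_add (hS : IsGeneratingFunction S) (n : ℕ) (r : Fin d → ℤ)
    (z : CotangentEuc d) :
    (hS.twistLift ^ n) (z + (intVec r, 0)) = (hS.twistLift ^ n) z + (intVec r, 0) := by
  induction n with
  | zero => rfl
  | succ n ih => rw [pow_succ', Equiv.Perm.mul_apply, Equiv.Perm.mul_apply, ih, hS.twistLift_add]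

theorem twistMap_pow_coverProj (hS : IsGeneratingFunction S) (n : ℕ) (z : CotangentEuc d) :
    (hS.twistMap ^ n) (coverProj z) = coverProj ((hS.twistLift ^ n) z) := by
  induction n with
  | zero => rfl
  | succ n ih =>
    rw [pow_succ', Equiv.Perm.mul_apply, pow_succ', Equiv.Perm.mul_apply, ih]
    rfl

end IsGeneratingFunction

/-! ### The charts of the cotangent bundle of the torus -/

theorem chartAt_torus_symm (q : Torus d) (u : Euc d) :
    (chartAt (Euc d) q).symm u = QuotientAddGroup.mk u := by
  change ((isLocalHomeomorph_mk d).localInverseAt _).symm u = _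
  simp

theorem continuous_coverProj : Continuous (coverProj (d := d)) :=
  (QuotientAddGroup.continuous_mk.comp continuous_fst).prodMk continuous_snd

theorem extChartAt_symm_eq (w : CotangentTorus d) (z : CotangentEuc d) :
    (extChartAt (cotangentModel d) w).symm z = coverProj z := by
  simp only [mfld_simps]
  exact Prod.ext (chartAt_torus_symm _ _) rfl

theorem coverProj_extChartAt {w w' : CotangentTorus d}
    (h : w' ∈ (extChartAt (cotangentModel d) w).source) :
    coverProj (extChartAt (cotangentModel d) w w') = w' := by
  rw [← extChartAt_symm_eq w]
  exact (extChartAt (cotangentModel d) w).left_inv h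

theorem coverProj_eq_iff {z z' : CotangentEuc d} :
    coverProj z = coverProj z' ↔ ∃ r : Fin d → ℤ, z' = z + (intVec r, 0) := by
  constructor
  · intro h
    obtain ⟨h1, h2⟩ := Prod.ext_iff.mp h
    obtain ⟨r, hr⟩ := QuotientAddGroup.eq.mp h1
    refine ⟨r, Prod.ext ?_ ?_⟩
    · simp [hr]
    · exact h2.symm.trans (add_zero _).symm
  · rintro ⟨r, rfl⟩
    refine Prod.ext ?_ (by simp [coverProj])
    exact (QuotientAddGroup.mk_add_of_mem _ (show intVec r ∈ intLattice d from ⟨r, rfl⟩)).symm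

/-- A chart of `T^*𝕋^d`, read through the covering, is locally a translation. -/
theorem extChartAt_coverProj_eventuallyEq (w : CotangentTorus d) {v : CotangentEuc d}
    (hv : coverProj v ∈ (extChartAt (cotangentModel d) w).source) :
    ∃ r : Fin d → ℤ, ∀ᶠ u in 𝓝 v,
      extChartAt (cotangentModel d) w (coverProj u) = u + (intVec r, 0) := by
  set φ := extChartAt (cotangentModel d) w
  have hsrc : ∀ᶠ u in 𝓝 v, coverProj u ∈ φ.source :=
    continuous_coverProj.continuousAt.eventually
      ((isOpen_extChartAt_source w).eventually_mem hv)
  have hint : ∀ u, coverProj u ∈ φ.source → ∃ r : Fin d → ℤ, φ (coverProj u) = u + (intVec r, 0) :=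
    fun u hu => coverProj_eq_iff.mp (coverProj_extChartAt hu).symm
  obtain ⟨r, hr⟩ := hint v hv
  -- The translation vector depends continuously on `u` and has values in the discrete group `ℤ^d`,
  -- so it is locally constant.
  have hcont : ContinuousAt (fun u => (φ (coverProj u) - u).1) v :=
    continuous_fst.continuousAt.comp
      ((ContinuousAt.comp (continuousAt_extChartAt' hv) continuous_coverProj.continuousAt).sub
        continuousAt_id)
  have hmem : intVec r ∈ (intLattice d : Set (Euc d)) := ⟨r, rfl⟩
  have hval : (φ (coverProj v) - v).1 = intVec r := by rw [hr]; simp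
  have hdisc := (isDiscrete_iff_nhdsWithin.mp (isDiscrete_intLattice d)) _ hmem
  have hev : ∀ᶠ l in 𝓝 (intVec r : Euc d), l ∈ (intLattice d : Set (Euc d)) → l = intVec r := by
    have : ∀ᶠ l in 𝓝[(intLattice d : Set (Euc d))] (intVec r : Euc d), l = intVec r := by
      rw [hdisc]; exact eventually_pure.mpr rfl
    exact eventually_nhdsWithin_iff.mp this
  rw [← hval] at hev
  refine ⟨r, ?_⟩
  filter_upwards [hsrc, hcont.eventually hev] with u hu hu'
  obtain ⟨s, hs⟩ := hint u hu
  have h1 : (φ (coverProj u) - u).1 = intVec s := by rw [hs]; simp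
  have h2 := hu' (by rw [h1]; exact ⟨s, rfl⟩)
  rw [h1, hval] at h2
  rw [hs, h2]

/-- The differential of a self-map of `T^*𝕋^d` is computed on a lift of this map. -/
theorem mfderiv_eq_fderiv_lift {f : CotangentEuc d → CotangentEuc d}
    {F : CotangentTorus d → CotangentTorus d} (hF : ∀ z, F (coverProj z) = coverProj (f z))
    (hf : Differentiable ℝ f) (w : CotangentTorus d) :
    MDifferentiableAt (cotangentModel d) (cotangentModel d) F w ∧
      (mfderiv (cotangentModel d) (cotangentModel d) F w : CotangentEuc d →L[ℝ] CotangentEuc d) =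
        fderiv ℝ f (extChartAt (cotangentModel d) w w) := by
  set z := extChartAt (cotangentModel d) w w with hz
  have hzw : coverProj z = w := coverProj_extChartAt (mem_extChartAt_source w)
  have hFcont : ContinuousAt F w := by
    -- The covering is open and surjective, hence a quotient map, and continuity of `F` can be
    -- checked on the lift.
    have hopen : IsOpenMap (coverProj (d := d)) :=
      (isLocalHomeomorph_mk d).isOpenMap.prodMap IsOpenMap.id
    have h : Continuous F := by
      rw [(IsOpenMap.isQuotientMap hopen continuous_coverProj
        coverProj_surjective).continuous_iff, show F ∘ coverProj = coverProj ∘ f from funext hF]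
      exact continuous_coverProj.comp hf.continuous
    exact h.continuousAt
  obtain ⟨r, hr⟩ := extChartAt_coverProj_eventuallyEq (F w) (v := f z)
    (by rw [← hF, hzw]; exact mem_extChartAt_source _)
  have hev : writtenInExtChartAt (cotangentModel d) (cotangentModel d) w F =ᶠ[𝓝 z]
      fun u => f u + (intVec r, 0) := by
    filter_upwards [hf.continuous.continuousAt.eventually hr] with u hu
    simp only [writtenInExtChartAt, Function.comp_apply, extChartAt_symm_eq, hF]
    exact hu
  have hder : HasFDerivAt (writtenInExtChartAt (cotangentModel d) (cotangentModel d) w F)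
      (fderiv ℝ f z) z :=
    ((hf z).hasFDerivAt.add_const _).congr_of_eventuallyEq hev
  have hrange : Set.range (cotangentModel d) = Set.univ := by
    simp
  have hmd : MDifferentiableAt (cotangentModel d) (cotangentModel d) F w := by
    rw [mdifferentiableAt_iff]
    exact ⟨hFcont, hder.differentiableAt.differentiableWithinAt⟩
  refine ⟨hmd, ?_⟩
  rw [hmd.mfderiv, hrange, fderivWithin_univ]
  exact hder.fderiv

namespace IsGeneratingFunction

/-- Absence of conjugate points, for the lifted twist map. -/
theorem NoConjugatePoints.lift {hS : IsGeneratingFunction S} (h : hS.NoConjugatePoints)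
    (z : CotangentEuc d) {n : ℕ} (hn : n ≠ 0) {η : Dual d}
    (hη : (fderiv ℝ (hS.twistLift ^ n : Equiv.Perm (CotangentEuc d)) z (0, η)).1 = 0) : η = 0 := by
  set w := coverProj z with hw
  obtain ⟨-, hder⟩ := mfderiv_eq_fderiv_lift (hS.twistMap_pow_coverProj n)
    ((hS.contDiff_twistLift_pow n).differentiable one_ne_zero) w
  have hdisj := h w n (by exact_mod_cast hn)
  obtain ⟨r, hr⟩ := coverProj_eq_iff.mp
    (hw.symm.trans (coverProj_extChartAt (mem_extChartAt_source (I := cotangentModel d) w)).symm)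
  -- The chart at `w` may pick another lift than `z`; the differentials at the two lifts agree
  -- because the iterates commute with integer translations.
  have htrans : fderiv ℝ (hS.twistLift ^ n : Equiv.Perm (CotangentEuc d)) (z + (intVec r, 0)) =
      fderiv ℝ (hS.twistLift ^ n : Equiv.Perm (CotangentEuc d)) z := by
    rw [← fderiv_comp_add_right]
    simp only [hS.twistLift_pow_add, fderiv_add_const]
  rw [hr, htrans] at hder
  have hvert : ∀ (w' : CotangentTorus d) (v : Euc d × Dual d), v.1 = 0 →
      (v : TangentSpace (cotangentModel d) w') ∈ verticalSpace w' := by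
    intro w' v hv
    have := mfderiv_fst (I := 𝓘(ℝ, Euc d)) (I' := 𝓘(ℝ, Dual d)) (x := w')
    change (mfderiv (cotangentModel d) 𝓘(ℝ, Euc d) (Prod.fst : CotangentTorus d → Torus d) w' :
      (Euc d × Dual d) →L[ℝ] Euc d) v = 0
    rw [show (mfderiv (cotangentModel d) 𝓘(ℝ, Euc d) (Prod.fst : CotangentTorus d → Torus d) w' :
      (Euc d × Dual d) →L[ℝ] Euc d) = ContinuousLinearMap.fst ℝ (Euc d) (Dual d) from this]
    exact hv
  rw [zpow_natCast] at hdisj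
  have hmem : (fderiv ℝ (hS.twistLift ^ n : Equiv.Perm (CotangentEuc d)) z (0, η) :
      TangentSpace (cotangentModel d) ((hS.twistMap ^ n) w)) ∈
      verticalSpace ((hS.twistMap ^ n) w) ⊓
      (verticalSpace w).map (mfderiv (cotangentModel d) (cotangentModel d)
        (hS.twistMap ^ n : Equiv.Perm (CotangentTorus d)) w).toLinearMap := by
    refine ⟨hvert _ _ hη, (0, η), hvert _ _ rfl, ?_⟩
    exact DFunLike.congr_fun hder ((0, η) : Euc d × Dual d)
  rw [hdisj] at hmem
  -- The intersection being trivial kills only the image vector; injectivity of the differential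
  -- then kills `η`.
  have hzero : fderiv ℝ (hS.twistLift ^ n : Equiv.Perm (CotangentEuc d)) z (0, η) = 0 := hmem
  have := hS.injective_fderiv_twistLift_pow n z (hzero.trans (map_zero _).symm)
  exact (Prod.mk_eq_zero.mp this).2

end IsGeneratingFunction

end TwistMap

/-! ### Uniqueness of critical points by gradient descent -/

section GradientDescent

open Metric Set

variable {H : Type*} [NormedAddCommGroup H] [InnerProductSpace ℝ H] [FiniteDimensional ℝ H]
  {W : H → ℝ} {g : H → H}

/-- The gradient is Lipschitz on bounded sets, so along a short step it keeps at least half of its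
component in the initial direction. The estimate covers all steps `s` up to `τ`, not just `τ`: this
is what prevents a step from jumping over a level barrier. -/
theorem exists_gradient_descent_step (hW : ∀ x, HasFDerivAt W (innerSL ℝ (g x)) x)
    (hg : ContDiff ℝ 1 g) (R : ℝ) :
    ∃ τ > 0, ∀ x ∈ closedBall (0 : H) R, ∀ s ∈ Icc 0 τ,
      W (x - s • g x) ≤ W x - s / 2 * ‖g x‖ ^ 2 := by
  obtain ⟨G, hG⟩ := (isCompact_closedBall (0 : H) R).exists_bound_of_continuousOn
    hg.continuous.continuousOn
  obtain ⟨L, hL⟩ := (isCompact_closedBall (0 : H) (R + G)).exists_bound_of_continuousOn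
    (hg.continuous_fderiv one_ne_zero).continuousOn
  have hlip : ∀ x ∈ closedBall (0 : H) (R + G), ∀ y ∈ closedBall (0 : H) (R + G),
      ‖g y - g x‖ ≤ L * ‖y - x‖ := fun x hx y hy =>
    (convex_closedBall (0 : H) (R + G)).norm_image_sub_le_of_norm_fderiv_le
      (fun z _ => hg.differentiable one_ne_zero z) hL hx hy
  have hpos : 0 < 2 * (|L| + 1) := by positivity
  -- The bound `s ≤ 1` keeps the step in the ball of radius `R + G`, where `L` bounds the derivative
  -- of `g`; the other bound gives `L * s ≤ 1 / 2`.
  refine ⟨min 1 (2 * (|L| + 1))⁻¹, lt_min one_pos (inv_pos.mpr hpos), ?_⟩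
  rintro x hx s ⟨hs0, hs⟩
  have hs1 : s ≤ 1 := hs.trans (min_le_left _ _)
  have hs2 : s * (2 * (|L| + 1)) ≤ 1 := by
    have := hs.trans (min_le_right _ _)
    rwa [← one_div, le_div_iff₀ hpos] at this
  rcases hs0.eq_or_lt with rfl | hs0
  · simp
  have hder : ∀ t : ℝ, HasDerivAt (fun t : ℝ => W (x - t • g x))
      (inner ℝ (g (x - t • g x)) (-g x)) t := by
    intro t
    have h1 : HasDerivAt (fun t : ℝ => x - t • g x) (-g x) t := by
      simpa using ((hasDerivAt_id t).smul_const (g x)).const_sub x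
    exact (hW _).comp_hasDerivAt t h1
  obtain ⟨c, ⟨hc0, hcs⟩, hc⟩ := exists_hasDerivAt_eq_slope _ _ hs0
    (fun t _ => (hder t).continuousAt.continuousWithinAt) (fun t _ => hder t)
  have hgx := hG x hx
  have hxR : x ∈ closedBall (0 : H) (R + G) :=
    closedBall_subset_closedBall (by linarith [norm_nonneg (g x)]) hx
  have hcgx : ‖c • g x‖ = c * ‖g x‖ := by rw [norm_smul, Real.norm_of_nonneg hc0.le]
  have hyR : x - c • g x ∈ closedBall (0 : H) (R + G) := by
    rw [mem_closedBall_zero_iff] at hx ⊢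
    have h1 := norm_sub_le x (c • g x)
    rw [hcgx] at h1
    nlinarith [norm_nonneg (g x)]
  have h1 := hlip x hxR _ hyR
  rw [sub_sub_cancel_left, norm_neg, hcgx] at h1
  have h2 : ‖g x‖ ^ 2 - inner ℝ (g (x - c • g x)) (g x) ≤ 1 / 2 * ‖g x‖ ^ 2 := by
    rw [← real_inner_self_eq_norm_sq, ← inner_sub_left, real_inner_self_eq_norm_sq]
    have h3 := real_inner_le_norm (g x - g (x - c • g x)) (g x)
    rw [norm_sub_rev] at h3
    have h4 : L * c ≤ 1 / 2 := by
      nlinarith [le_abs_self L, abs_nonneg L, mul_le_mul_of_nonneg_left hcs.le (abs_nonneg L)]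
    have h5 : ‖g (x - c • g x) - g x‖ * ‖g x‖ ≤ L * (c * ‖g x‖) * ‖g x‖ :=
      mul_le_mul_of_nonneg_right h1 (norm_nonneg _)
    nlinarith [sq_nonneg ‖g x‖]
  rw [eq_div_iff (by linarith), inner_neg_right] at hc
  simp only [sub_zero, zero_smul] at hc
  nlinarith

/-- A coercive function whose critical points are all nondegenerate minima has at most one critical
point. -/
theorem eq_of_gradient_eq_zero (hW : ∀ x, HasFDerivAt W (innerSL ℝ (g x)) x)
    (hg : ContDiff ℝ 1 g) (hcoer : Tendsto W (cocompact H) atTop)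
    (hpos : ∀ c, g c = 0 → ∃ ρ > 0, ∀ x ∈ closedBall c ρ, x ≠ c → 0 < inner ℝ (g x) (x - c))
    {c₁ c₂ : H} (h₁ : g c₁ = 0) (h₂ : g c₂ = 0) : c₁ = c₂ := by
  have hWc : Continuous W := continuous_iff_continuousAt.mpr fun x => (hW x).continuousAt
  have hbdd : ∀ M, ∃ R, {x | W x ≤ M} ⊆ closedBall 0 R := by
    intro M
    have h1 : ∀ᶠ x in cocompact H, M < W x := hcoer.eventually_gt_atTop M
    rw [← Metric.cobounded_eq_cocompact] at h1
    have h2 : Bornology.IsBounded {x | ¬ M < W x} := by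
      rw [← Bornology.isCobounded_compl_iff]
      rw [Bornology.isCobounded_def, show {x | ¬ M < W x}ᶜ = {x | M < W x} by ext; simp]
      exact h1
    simpa only [not_lt] using h2.subset_closedBall 0
  set R₀ := max ‖c₁‖ ‖c₂‖
  have hB : IsPreconnected (closedBall (0 : H) R₀) := (convex_closedBall _ _).isPreconnected
  have hc₁ : c₁ ∈ closedBall (0 : H) R₀ := mem_closedBall_zero_iff.mpr (le_max_left _ _)
  have hc₂ : c₂ ∈ closedBall (0 : H) R₀ := mem_closedBall_zero_iff.mpr (le_max_right _ _)
  -- The sublevel set `W ≤ M` is compact and invariant under descent, but possibly disconnected.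
  -- Connectedness is used on the ball inside it, which contains both critical points.
  obtain ⟨M, hM⟩ := (isCompact_closedBall (0 : H) R₀).exists_bound_of_continuousOn
    hWc.continuousOn
  obtain ⟨R, hR⟩ := hbdd M
  have hBK : ∀ x ∈ closedBall (0 : H) R₀, W x ≤ M := fun x hx => (le_abs_self _).trans (hM x hx)
  obtain ⟨τ, hτ, hstep⟩ := exists_gradient_descent_step hW hg R
  set T : H → H := fun x => x - τ • g x with hT
  have hTc : Continuous T := continuous_id.sub (hg.continuous.const_smul τ)
  have hTW : ∀ x, W x ≤ M → W (T x) ≤ W x - τ / 2 * ‖g x‖ ^ 2 := fun x hx =>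
    hstep x (hR hx) τ ⟨hτ.le, le_rfl⟩
  have hTle : ∀ x, W x ≤ M → W (T x) ≤ W x := fun x hx =>
    (hTW x hx).trans (by have : 0 ≤ τ / 2 * ‖g x‖ ^ 2 := by positivity
                         linarith)
  have hitM : ∀ x, W x ≤ M → ∀ n, W (T^[n] x) ≤ M := by
    intro x hx n
    induction n with
    | zero => exact hx
    | succ n ih => rw [Function.iterate_succ_apply']; exact (hTle _ ih).trans ih
  have hcompact : IsCompact {x | W x ≤ M} :=
    (isCompact_closedBall 0 R).of_isClosed_subset (isClosed_le hWc continuous_const) hR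
  -- Every trajectory has a cluster point `c`. Since `W` decreases along the trajectory to `W c`,
  -- one more step from `c` cannot decrease `W`, which forces `g c = 0`.
  have hclus : ∀ x, W x ≤ M → ∃ c, g c = 0 ∧ ∃ φ : ℕ → ℕ, StrictMono φ ∧
      Tendsto (fun k => T^[φ k] x) atTop (𝓝 c) := by
    intro x hx
    obtain ⟨c, hcM, φ, hφ, hlim⟩ := hcompact.tendsto_subseq (hitM x hx)
    refine ⟨c, ?_, φ, hφ, hlim⟩
    have hanti : Antitone fun n => W (T^[n] x) := antitone_nat_of_succ_le fun n => by
      rw [Function.iterate_succ_apply']; exact hTle _ (hitM x hx n)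
    have hlimW : Tendsto (fun k => W (T^[φ k] x)) atTop (𝓝 (W c)) :=
      (hWc.tendsto c).comp hlim
    have hall : ∀ n, W c ≤ W (T^[n] x) := fun n =>
      le_of_tendsto hlimW (eventually_atTop.mpr ⟨n, fun k hk =>
        hanti (hk.trans (hφ.id_le k))⟩)
    have hlimT : Tendsto (fun k => W (T (T^[φ k] x))) atTop (𝓝 (W (T c))) :=
      ((hWc.comp hTc).tendsto c).comp hlim
    have h1 : W c ≤ W (T c) := ge_of_tendsto hlimT (Eventually.of_forall fun k => by
      rw [← Function.iterate_succ_apply' T]; exact hall _)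
    have h2 := hTW c hcM
    have h3 : ‖g c‖ ^ 2 ≤ 0 := by
      by_contra! h
      have : 0 < τ / 2 * ‖g c‖ ^ 2 := by positivity
      linarith
    exact norm_eq_zero.mp (pow_eq_zero_iff two_ne_zero |>.mp (le_antisymm h3 (sq_nonneg _)))
  -- Each critical point has a trapping neighbourhood: the part of a small ball on which `W` stays
  -- below its minimum over the bounding sphere.
  have hnbhd : ∀ c, g c = 0 → ∃ N : Set H, IsOpen N ∧ c ∈ N ∧
      (∀ x ∈ N, W x ≤ M → T x ∈ N) ∧ ∀ y ∈ closure N, g y = 0 → y = c := by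
    intro c hc
    obtain ⟨ρ, hρ, hin⟩ := hpos c hc
    have hmin : ∀ x ∈ closedBall c ρ, x ≠ c → W c < W x := by
      intro x hx hxc
      have hder : ∀ t : ℝ, HasDerivAt (fun t : ℝ => W (c + t • (x - c)))
          (inner ℝ (g (c + t • (x - c))) (x - c)) t := by
        intro t
        have h1 : HasDerivAt (fun t : ℝ => c + t • (x - c)) (x - c) t := by
          simpa using ((hasDerivAt_id t).smul_const (x - c)).const_add c
        exact (hW _).comp_hasDerivAt t h1
      obtain ⟨t, ⟨ht0, ht1⟩, ht⟩ := exists_hasDerivAt_eq_slope _ _ (zero_lt_one (α := ℝ))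
        (fun t _ => (hder t).continuousAt.continuousWithinAt) (fun t _ => hder t)
      have hxc' : x - c ≠ 0 := sub_ne_zero.mpr hxc
      have h2 := hin (c + t • (x - c)) (by
        rw [mem_closedBall_iff_norm] at hx ⊢
        rw [add_sub_cancel_left, norm_smul, Real.norm_of_nonneg ht0.le]
        nlinarith [norm_nonneg (x - c)]) (by simpa using ⟨ht0.ne', hxc'⟩)
      rw [add_sub_cancel_left, inner_smul_right] at h2
      have h3 := pos_of_mul_pos_right h2 ht0.le
      rw [ht] at h3
      simp at h3
      exact h3
    obtain ⟨β, hβc, hβ⟩ : ∃ β, W c < β ∧ ∀ x ∈ sphere c ρ, β ≤ W x := by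
      -- The sphere is empty when `H` is trivial.
      rcases (sphere c ρ).eq_empty_or_nonempty with he | hne
      · exact ⟨W c + 1, by linarith, by simp [he]⟩
      · obtain ⟨y, hy, hymin⟩ := (isCompact_sphere c ρ).exists_isMinOn hne hWc.continuousOn
        exact ⟨W y, hmin y (sphere_subset_closedBall hy) (ne_of_mem_sphere hy hρ.ne'),
          fun x hx => hymin hx⟩
    refine ⟨ball c ρ ∩ {x | W x < β}, isOpen_ball.inter (isOpen_lt hWc continuous_const),
      ⟨mem_ball_self hρ, hβc⟩, ?_, ?_⟩
    · rintro x ⟨hxb, hxβ⟩ hxM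
      refine ⟨?_, (hTle x hxM).trans_lt hxβ⟩
      by_contra hout
      -- A step leaving the ball would cross the sphere at some intermediate time `s`, where `W` is
      -- at least `β`, although `W` has not increased.
      have hcont : ContinuousOn (fun s : ℝ => dist (x - s • g x) c) (Icc 0 τ) := by fun_prop
      obtain ⟨s, hs, hsρ⟩ := intermediate_value_Icc hτ.le hcont
        (show ρ ∈ Icc _ _ from ⟨by simpa using (mem_ball.mp hxb).le, not_lt.mp hout⟩)
      have h1 := hβ _ (mem_sphere.mpr hsρ)
      have h2 := hstep x (hR hxM) s hs
      have : 0 ≤ s / 2 * ‖g x‖ ^ 2 := by have := hs.1; positivity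
      have : W x < β := hxβ
      linarith
    · intro y hy hgy
      by_contra hne
      have hy' : y ∈ closedBall c ρ :=
        closure_minimal (inter_subset_left.trans ball_subset_closedBall) isClosed_closedBall hy
      have := hin y hy' hne
      rw [hgy, inner_zero_left] at this
      exact lt_irrefl _ this
  choose! N hNo hcN hNT hNc using hnbhd
  have hstay : ∀ c, g c = 0 → ∀ x, W x ≤ M → ∀ n, T^[n] x ∈ N c → ∀ m, n ≤ m → T^[m] x ∈ N c := by
    intro c hc x hx n hn m hm
    induction m, hm using Nat.le_induction with
    | base => exact hn
    | succ m _ ih =>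
      rw [Function.iterate_succ_apply']
      exact hNT c hc _ ih (hitM x hx m)
  -- A trajectory that enters the neighbourhood of `c` stays there, and `c` is the only critical
  -- point in its closure; so basins of distinct critical points are disjoint.
  have huniq : ∀ c, g c = 0 → ∀ x, W x ≤ M → ∀ n, T^[n] x ∈ N c → ∀ p, g p = 0 →
      ∀ φ : ℕ → ℕ, StrictMono φ → Tendsto (fun k => T^[φ k] x) atTop (𝓝 p) → p = c := by
    intro c hc x hx n hn p hp φ hφ hlim
    refine hNc c hc p (mem_closure_of_tendsto hlim ?_) hp
    exact eventually_atTop.mpr ⟨n, fun k hk => hstay c hc x hx n hn _ (hk.trans (hφ.id_le k))⟩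
  by_contra hne
  have hopen : ∀ c, g c = 0 → IsOpen {x | ∃ n, T^[n] x ∈ N c} := by
    intro c hc
    simp only [ofPred_exists]
    exact isOpen_iUnion fun n => (hNo c hc).preimage (hTc.iterate n)
  -- The basin of `c₁` and the union of the other basins are open and cover the connected ball; both
  -- meet it, so they would have a common point.
  obtain ⟨x, hxB, ⟨n, hn⟩, hxV⟩ := hB {x | ∃ n, T^[n] x ∈ N c₁}
    (⋃ c ∈ {c | g c = 0 ∧ c ≠ c₁}, {x | ∃ n, T^[n] x ∈ N c}) (hopen c₁ h₁)
    (isOpen_biUnion fun c hc => hopen c hc.1)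
    (by
      intro x hx
      obtain ⟨c, hc, φ, -, hlim⟩ := hclus x (hBK x hx)
      obtain ⟨k, hk⟩ := (hlim.eventually ((hNo c hc).mem_nhds (hcN c hc))).exists
      by_cases h : c = c₁
      · exact Or.inl ⟨φ k, h ▸ hk⟩
      · exact Or.inr (mem_biUnion (show c ∈ {c | g c = 0 ∧ c ≠ c₁} from ⟨hc, h⟩) ⟨φ k, hk⟩))
    ⟨c₁, hc₁, 0, hcN c₁ h₁⟩
    ⟨c₂, hc₂, mem_biUnion (show c₂ ∈ {c | g c = 0 ∧ c ≠ c₁} from ⟨h₂, Ne.symm hne⟩)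
      ⟨0, hcN c₂ h₂⟩⟩
  obtain ⟨c, ⟨hc, hcne⟩, m, hm⟩ := mem_iUnion₂.mp hxV
  obtain ⟨p, hp, φ, hφ, hlim⟩ := hclus x (hBK x hxB)
  exact hcne ((huniq c hc x (hBK x hxB) m hm p hp φ hφ hlim).symm.trans
    (huniq c₁ h₁ x (hBK x hxB) n hn p hp φ hφ hlim))

end GradientDescent

namespace TwistMap

variable {d : ℕ} {S : Euc d × Euc d → ℝ}

/-! ### Periodic functions -/

theorem exists_isCompact_fundamental (d : ℕ) :
    ∃ K : Set (Euc d), IsCompact K ∧ K.Nonempty ∧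
      ∀ u, ∃ r : Fin d → ℤ, u + intVec r ∈ K := by
  refine ⟨WithLp.toLp 2 '' Set.pi Set.univ fun _ => Set.Icc (0 : ℝ) 1,
    (isCompact_univ_pi fun _ => isCompact_Icc).image (PiLp.continuous_toLp 2 _),
    ⟨WithLp.toLp 2 0, 0, fun _ _ => ⟨le_rfl, zero_le_one⟩, rfl⟩, fun u => ?_⟩
  refine ⟨fun i => -⌊u i⌋, fun i => Int.fract (u i), fun i _ =>
    ⟨Int.fract_nonneg _, (Int.fract_lt_one _).le⟩, ?_⟩
  ext i
  simp [intVec, Int.fract, sub_eq_add_neg]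

theorem exists_forall_norm_le_of_periodic {F : Type*} [NormedAddCommGroup F] {φ : Euc d → F}
    (hφ : Continuous φ) (hper : ∀ u (r : Fin d → ℤ), φ (u + intVec r) = φ u) :
    ∃ C, ∀ u, ‖φ u‖ ≤ C := by
  obtain ⟨K, hK, -, hfund⟩ := exists_isCompact_fundamental d
  obtain ⟨C, hC⟩ := hK.exists_bound_of_continuousOn hφ.continuousOn
  refine ⟨C, fun u => ?_⟩
  obtain ⟨r, hr⟩ := hfund u
  rw [← hper u r]
  exact hC _ hr

theorem exists_forall_ge_of_periodic {φ : Euc d → ℝ}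
    (hφ : Continuous φ) (hper : ∀ u (r : Fin d → ℤ), φ (u + intVec r) = φ u) :
    ∃ a, ∀ u, φ u ≤ φ a := by
  obtain ⟨K, hK, hne, hfund⟩ := exists_isCompact_fundamental d
  obtain ⟨a, -, ha⟩ := hK.exists_isMaxOn hne hφ.continuousOn
  refine ⟨a, fun u => ?_⟩
  obtain ⟨r, hr⟩ := hfund u
  rw [← hper u r]
  exact ha hr

/-! ### Coercivity of generating functions -/

namespace IsGeneratingFunction

theorem fderiv_apply_inl (hS : IsGeneratingFunction S) (q : Euc d × Euc d) (v : Euc d) :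
    fderiv ℝ S q (v, 0) = d1 S q.1 q.2 v := by
  rw [hS.d1_eq]; rfl

theorem fderiv_apply_inr (hS : IsGeneratingFunction S) (q : Euc d × Euc d) (v : Euc d) :
    fderiv ℝ S q (0, v) = d2 S q.1 q.2 v := by
  rw [hS.d2_eq]; rfl

/-- Put `v = y - x`. Moving the first argument from the diagonal back to `x`, the twist condition
gives `∂₂S(x, x + s v) v ≥ A s ‖v‖² - C ‖v‖`, the diagonal term being bounded by periodicity.
Integration in `s` yields quadratic growth of `S`, of which only a linear part is kept. -/
theorem exists_forall_norm_sub_le (hS : IsGeneratingFunction S) :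
    ∃ K : ℝ, ∀ x y, ‖y - x‖ - K ≤ S (x, y) := by
  obtain ⟨A, hA, hAS⟩ := hS.twist
  obtain ⟨C, hC⟩ := exists_forall_norm_le_of_periodic (φ := fun u => d2 S u u)
    (hS.contDiff_d2_uncurry.continuous.comp (continuous_id.prodMk continuous_id))
    fun u r => hS.d2_add r u u
  obtain ⟨C', hC'⟩ := exists_forall_norm_le_of_periodic (φ := fun u => S (u, u))
    (hS.contDiff.continuous.comp (continuous_id.prodMk continuous_id))
    fun u r => hS.periodic r u u
  refine ⟨C' + (C + 1) ^ 2 / (2 * A), fun x y => ?_⟩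
  set v := y - x with hv
  have hline : ∀ t : ℝ, HasDerivAt (fun t : ℝ => x + t • v) v t := fun t => by
    simpa using ((hasDerivAt_id t).smul_const v).const_add x
  have hlow : ∀ s : ℝ, 0 < s → -C * ‖v‖ + A * s * ‖v‖ ^ 2 ≤ d2 S x (x + s • v) v := by
    intro s hs
    set u := x + s • v
    have hder : ∀ t : ℝ, HasDerivAt (fun t : ℝ => d2 S (x + t • v) u v)
        (fderiv ℝ (fun x' => d2 S x' u) (x + t • v) v v) t := by
      intro t
      have h2 := HasFDerivAt.comp_hasDerivAt (l := fun x' => d2 S x' u) t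
        ((hS.contDiff_d2 u).differentiable one_ne_zero (x + t • v)).hasFDerivAt (hline t)
      simpa using h2.clm_apply (hasDerivAt_const t v)
    obtain ⟨c, -, hc⟩ := exists_hasDerivAt_eq_slope _ _ hs
      (fun t _ => (hder t).continuousAt.continuousWithinAt) (fun t _ => hder t)
    have h3 := hAS (x + c • v) u v
    rw [hc, div_le_iff₀ (by linarith)] at h3
    simp only [sub_zero, zero_smul, add_zero] at h3
    have h4 : -(C * ‖v‖) ≤ d2 S u u v := by
      have h5 := (neg_le_abs _).trans (((d2 S u u).le_opNorm v).trans
        (mul_le_mul_of_nonneg_right (hC u) (norm_nonneg v)))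
      linarith
    change d2 S u u v - d2 S x u v ≤ _ at h3
    nlinarith
  have hder : ∀ s : ℝ, HasDerivAt
      (fun s : ℝ => S (x, x + s • v) + C * ‖v‖ * s - A * ‖v‖ ^ 2 / 2 * s ^ 2)
      (d2 S x (x + s • v) v + C * ‖v‖ - A * s * ‖v‖ ^ 2) s := by
    intro s
    have h1 : HasDerivAt (fun s : ℝ => S (x, x + s • v)) (d2 S x (x + s • v) v) s :=
      HasFDerivAt.comp_hasDerivAt (l := fun y => S (x, y)) s
        (((hS.contDiff.differentiable two_ne_zero).comp
          (by fun_prop : Differentiable ℝ fun y => (x, y))) (x + s • v)).hasFDerivAt (hline s)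
    have h2 := (h1.add ((hasDerivAt_id s).const_mul (C * ‖v‖))).sub
      ((hasDerivAt_pow 2 s).const_mul (A * ‖v‖ ^ 2 / 2))
    refine h2.congr_deriv ?_
    push_cast
    ring
  obtain ⟨s, ⟨hs, -⟩, hsl⟩ := exists_hasDerivAt_eq_slope _ _ (zero_lt_one (α := ℝ))
    (fun t _ => (hder t).continuousAt.continuousWithinAt) (fun t _ => hder t)
  have h1 := hlow s hs
  have hy : x + (1 : ℝ) • v = y := by rw [one_smul, hv]; abel
  rw [hy] at hsl
  simp only [zero_smul, add_zero, mul_zero, sub_zero, mul_one, one_pow, div_one, ne_eq,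
    OfNat.ofNat_ne_zero, not_false_eq_true, zero_pow] at hsl
  have h2 := (neg_le_abs _).trans (hC' x)
  -- Completing the square replaces `A ‖v‖² / 2 - C ‖v‖` by the lower bound `‖v‖ - (C + 1)² / (2
  -- A)`.
  have h3 : 0 ≤ (A * ‖v‖ - (C + 1)) ^ 2 / (2 * A) := by positivity
  have h4 : (A * ‖v‖ - (C + 1)) ^ 2 / (2 * A) =
      A * ‖v‖ ^ 2 / 2 - (C + 1) * ‖v‖ + (C + 1) ^ 2 / (2 * A) := by
    field_simp
    ring
  linarith

end IsGeneratingFunction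

/-! ### Variations with fixed endpoints -/

/-- Variations of a segment `x_0, …, x_n` that vanish at both endpoints. -/
def Variation (d n : ℕ) : Type := PiLp 2 fun _ : Finset.Ioo 0 n => Euc d

namespace Variation

instance (d n : ℕ) : NormedAddCommGroup (Variation d n) :=
  inferInstanceAs (NormedAddCommGroup (PiLp 2 fun _ : Finset.Ioo 0 n => Euc d))

instance (d n : ℕ) : InnerProductSpace ℝ (Variation d n) :=
  inferInstanceAs (InnerProductSpace ℝ (PiLp 2 fun _ : Finset.Ioo 0 n => Euc d))

instance (d n : ℕ) : FiniteDimensional ℝ (Variation d n) :=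
  inferInstanceAs (FiniteDimensional ℝ (PiLp 2 fun _ : Finset.Ioo 0 n => Euc d))

variable {n : ℕ}

/-- The `k`-th entry of a variation, for `0 < k < n`. -/
def proj (k : Finset.Ioo 0 n) : Variation d n →L[ℝ] Euc d :=
  PiLp.proj (𝕜 := ℝ) 2 (fun _ : Finset.Ioo 0 n => Euc d) k

/-- The `k`-th entry of a variation; it is zero unless `0 < k < n`. -/
def coord (k : ℕ) : Variation d n →L[ℝ] Euc d :=
  if h : k ∈ Finset.Ioo 0 n then proj ⟨k, h⟩ else 0

theorem coord_of_mem {k : ℕ} (h : k ∈ Finset.Ioo 0 n) (c : Variation d n) :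
    coord k c = proj ⟨k, h⟩ c := by
  rw [coord, dif_pos h]

@[simp]
theorem coord_zero (c : Variation d n) : coord 0 c = 0 := by
  simp [coord]

@[simp]
theorem coord_last (c : Variation d n) : coord n c = 0 := by
  simp [coord]

theorem eq_zero_of_coord {c : Variation d n} (h : ∀ k, 0 < k → k < n → coord k c = 0) : c = 0 := by
  refine PiLp.ext ?_
  rintro ⟨k, hk⟩
  change proj ⟨k, hk⟩ c = 0
  rw [← coord_of_mem hk]
  exact h k (Finset.mem_Ioo.mp hk).1 (Finset.mem_Ioo.mp hk).2

theorem exists_coord_eq (y : ℕ → Euc d) (h0 : y 0 = 0) (hn : y n = 0) :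
    ∃ c : Variation d n, ∀ k ≤ n, coord k c = y k := by
  obtain ⟨c, hc⟩ : ∃ c : Variation d n, ∀ k, proj k c = y k :=
    ⟨(WithLp.toLp 2 fun k => y k : PiLp 2 fun _ : Finset.Ioo 0 n => Euc d), fun _ => rfl⟩
  refine ⟨c, fun k hk => ?_⟩
  by_cases h : k ∈ Finset.Ioo 0 n
  · rw [coord_of_mem h, hc]
  · rw [coord, dif_neg h]
    rw [Finset.mem_Ioo, not_and_or] at h
    rcases h with h | h
    · rw [Nat.eq_zero_of_not_pos h, h0]; rfl
    · rw [show k = n by omega, hn]; rfl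

theorem norm_sq_le {c : Variation d n} {M : ℝ} (h : ∀ k, 0 < k → k < n → ‖coord k c‖ ≤ M) :
    ‖c‖ ^ 2 ≤ n * M ^ 2 := by
  have h0 : ‖c‖ ^ 2 = ∑ k : Finset.Ioo 0 n, ‖proj k c‖ ^ 2 := PiLp.norm_sq_eq_of_L2 _ _
  rw [h0]
  have h1 : ∀ k : Finset.Ioo 0 n, ‖proj k c‖ ^ 2 ≤ M ^ 2 := by
    rintro ⟨k, hk⟩
    have := h k (Finset.mem_Ioo.mp hk).1 (Finset.mem_Ioo.mp hk).2
    rw [coord_of_mem hk] at this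
    exact pow_le_pow_left₀ (norm_nonneg _) this 2
  refine (Finset.sum_le_card_nsmul _ _ _ fun k _ => h1 k).trans ?_
  rw [nsmul_eq_mul]
  refine mul_le_mul_of_nonneg_right ?_ (sq_nonneg M)
  simp

/-- Summation by parts for variations with fixed endpoints. -/
theorem sum_coord_eq_zero_iff (P : ℕ → Euc d × Euc d →L[ℝ] ℝ) :
    (∀ η : Variation d n, ∑ k ∈ Finset.range n, P k (coord k η, coord (k + 1) η) = 0) ↔
      ∀ k, k + 1 < n → ∀ v, P k (0, v) + P (k + 1) (v, 0) = 0 := by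
  rcases n with - | m
  · simp
  have hsum : ∀ η : Variation d (m + 1),
      ∑ k ∈ Finset.range (m + 1), P k (coord k η, coord (k + 1) η) =
        ∑ k ∈ Finset.range m, (P k (0, coord (k + 1) η) + P (k + 1) (coord (k + 1) η, 0)) := by
    intro η
    have h1 : ∀ k, P k (coord k η, coord (k + 1) η) =
        P k (coord k η, 0) + P k (0, coord (k + 1) η) := fun k => by
      rw [← map_add, Prod.mk_add_mk, zero_add, add_zero]
    simp only [h1, Finset.sum_add_distrib]
    rw [Finset.sum_range_succ' (fun k => P k (coord k η, 0)), Finset.sum_range_succ]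
    simp only [coord_zero, coord_last, Prod.mk_zero_zero, map_zero]
    ring
  constructor
  · intro h k hk v
    obtain ⟨η, hη⟩ := exists_coord_eq (n := m + 1) (Pi.single (k + 1) v : ℕ → Euc d)
      (by simp) (by rw [Pi.single_eq_of_ne (by omega)])
    have h1 := h η
    rw [hsum, Finset.sum_eq_single k] at h1
    · rwa [hη _ (by omega), Pi.single_eq_same] at h1
    · intro j hj hjk
      rw [hη _ (by rw [Finset.mem_range] at hj; omega), Pi.single_eq_of_ne (by omega)]
      rw [← Prod.zero_eq_mk, map_zero, map_zero, add_zero]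
    · intro hk'
      exact absurd (Finset.mem_range.mpr (by omega)) hk'
  · intro h η
    rw [hsum]
    exact Finset.sum_eq_zero fun k hk => h k (by rw [Finset.mem_range] at hk; omega) _

end Variation

open Variation

/-! ### The action and its first two variations -/

/-- The action of the segment `y_0, …, y_n`. -/
def action (S : Euc d × Euc d → ℝ) (n : ℕ) (y : ℕ → Euc d) : ℝ :=
  ∑ k ∈ Finset.range n, S (y k, y (k + 1))

/-- The pair of consecutive entries `k`, `k + 1` of the sequence `y`, varied by `c`. -/
def variedPair {n : ℕ} (y : ℕ → Euc d) (c : Variation d n) (k : ℕ) : Euc d × Euc d :=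
  (y k + coord k c, y (k + 1) + coord (k + 1) c)

/-- The action of the sequence `y`, varied by `c`. -/
def variedAction (S : Euc d × Euc d → ℝ) (n : ℕ) (y : ℕ → Euc d) (c : Variation d n) : ℝ :=
  action S n fun k => y k + coord k c

/-- The first variation of the action. -/
def firstVariation (S : Euc d × Euc d → ℝ) (n : ℕ) (y : ℕ → Euc d) (c : Variation d n) :
    Variation d n →L[ℝ] ℝ :=
  ∑ k ∈ Finset.range n, (fderiv ℝ S (variedPair y c k)).comp ((coord k).prod (coord (k + 1)))

/-- The second variation of the action along the segment `y_0, …, y_n`. -/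
def secondVariation (S : Euc d × Euc d → ℝ) (n : ℕ) (y : ℕ → Euc d) (ξ η : Variation d n) : ℝ :=
  ∑ k ∈ Finset.range n, fderiv ℝ (fderiv ℝ S) (y k, y (k + 1))
    (coord k ξ, coord (k + 1) ξ) (coord k η, coord (k + 1) η)

theorem action_congr {n : ℕ} {y y' : ℕ → Euc d} (h : ∀ k ≤ n, y k = y' k) :
    action S n y = action S n y' := by
  refine Finset.sum_congr rfl fun k hk => ?_
  rw [Finset.mem_range] at hk
  rw [h k (by omega), h (k + 1) (by omega)]

theorem secondVariation_congr {n : ℕ} {y y' : ℕ → Euc d} (h : ∀ k ≤ n, y k = y' k)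
    (ξ η : Variation d n) : secondVariation S n y ξ η = secondVariation S n y' ξ η := by
  refine Finset.sum_congr rfl fun k hk => ?_
  rw [Finset.mem_range] at hk
  rw [h k (by omega), h (k + 1) (by omega)]

theorem secondVariation_smul {n : ℕ} (y : ℕ → Euc d)
    (ξ : Variation d n) (t : ℝ) :
    secondVariation S n y (t • ξ) (t • ξ) = t ^ 2 * secondVariation S n y ξ ξ := by
  simp only [secondVariation, Finset.mul_sum]
  refine Finset.sum_congr rfl fun k _ => ?_
  simp only [map_smul, ← Prod.smul_mk, _root_.smul_apply, smul_eq_mul]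
  ring

theorem hasFDerivAt_variedPair {n : ℕ} (y : ℕ → Euc d) (c : Variation d n) (k : ℕ) :
    HasFDerivAt (fun c => variedPair y c k) ((coord (d := d) (n := n) k).prod (coord (k + 1))) c :=
  ((coord k).hasFDerivAt.const_add _).prodMk ((coord (k + 1)).hasFDerivAt.const_add _)

theorem contDiff_variedPair {n : ℕ} (y : ℕ → Euc d) (k : ℕ) :
    ContDiff ℝ 1 (fun c : Variation d n => variedPair y c k) :=
  (contDiff_const.add (coord k).contDiff).prodMk (contDiff_const.add (coord (k + 1)).contDiff)

theorem firstVariation_apply {n : ℕ} (y : ℕ → Euc d) (c η : Variation d n) :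
    firstVariation S n y c η =
      ∑ k ∈ Finset.range n, fderiv ℝ S (variedPair y c k) (coord k η, coord (k + 1) η) := by
  simp [firstVariation]

namespace IsGeneratingFunction

variable {n : ℕ}

theorem hasFDerivAt_variedAction (hS : IsGeneratingFunction S) (y : ℕ → Euc d)
    (c : Variation d n) :
    HasFDerivAt (variedAction S n y) (firstVariation S n y c) c := by
  have h : ∀ k, HasFDerivAt (fun c : Variation d n => S (variedPair y c k)) _ c := fun k =>
    HasFDerivAt.comp (g := S) (f := fun c => variedPair y c k) c
    (hS.contDiff.differentiable two_ne_zero _).hasFDerivAt (hasFDerivAt_variedPair y c k)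
  exact HasFDerivAt.fun_sum (u := Finset.range n) fun k _ => h k

theorem contDiff_firstVariation (hS : IsGeneratingFunction S) (y : ℕ → Euc d) :
    ContDiff ℝ 1 (firstVariation S n y) := by
  refine ContDiff.sum fun k _ => ?_
  exact (hS.contDiff_fderiv.comp (contDiff_variedPair y k)).clm_comp contDiff_const

theorem fderiv_firstVariation (hS : IsGeneratingFunction S) (y : ℕ → Euc d)
    (c ξ η : Variation d n) :
    fderiv ℝ (firstVariation S n y) c ξ η =
      secondVariation S n (fun k => y k + coord k c) ξ η := by
  have h : ∀ k, HasFDerivAt (fun c : Variation d n =>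
      (fderiv ℝ S (variedPair y c k)).comp ((coord (d := d) (n := n) k).prod (coord (k + 1)))) _ c :=
    fun k => ((ContinuousLinearMap.compL ℝ (Variation d n) (Euc d × Euc d) ℝ).flip
      ((coord k).prod (coord (k + 1)))).hasFDerivAt.comp c
        ((hS.hasFDerivAt_fderiv (variedPair y c k)).comp c (hasFDerivAt_variedPair y c k))
  have h' : HasFDerivAt (firstVariation S n y) _ c := HasFDerivAt.fun_sum fun k _ => h k
  rw [h'.fderiv]
  simp only [_root_.sum_apply]
  rfl

theorem secondVariation_symm (hS : IsGeneratingFunction S) (y : ℕ → Euc d)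
    (ξ η : Variation d n) : secondVariation S n y ξ η = secondVariation S n y η ξ :=
  Finset.sum_congr rfl fun _ _ => hS.fderiv_fderiv_symm _ _ _

theorem firstVariation_eq_zero_iff (hS : IsGeneratingFunction S) (y : ℕ → Euc d)
    (c : Variation d n) :
    firstVariation S n y c = 0 ↔ ∀ k, k + 1 < n →
      d2 S (y k + coord k c) (y (k + 1) + coord (k + 1) c) +
        d1 S (y (k + 1) + coord (k + 1) c) (y (k + 2) + coord (k + 2) c) = 0 := by
  rw [ContinuousLinearMap.ext_iff]
  simp only [firstVariation_apply, _root_.zero_apply]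
  rw [sum_coord_eq_zero_iff (fun k => fderiv ℝ S (variedPair y c k))]
  simp only [hS.fderiv_apply_inl, hS.fderiv_apply_inr]
  refine forall₂_congr fun k _ => ?_
  rw [ContinuousLinearMap.ext_iff]
  rfl

/-- Each step satisfies `‖y (k + 1) - y k‖ ≤ S (y k, y (k + 1)) + K`. Steps up to `j` add up by the
triangle inequality, and the later ones contribute nonnegative terms. -/
theorem norm_sub_le_action (hS : IsGeneratingFunction S) :
    ∃ K : ℝ, ∀ n (y : ℕ → Euc d), ∀ j ≤ n, ‖y j - y 0‖ ≤ action S n y + n * K := by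
  obtain ⟨K, hK⟩ := hS.exists_forall_norm_sub_le
  refine ⟨K, fun n y => ?_⟩
  have hstep : ∀ k, ‖y (k + 1) - y k‖ ≤ S (y k, y (k + 1)) + K := fun k => by
    linarith [hK (y k) (y (k + 1))]
  induction n with
  | zero => intro j hj; simp [Nat.le_zero.mp hj, action]
  | succ n ih =>
    have hact : action S (n + 1) y = action S n y + S (y n, y (n + 1)) := Finset.sum_range_succ _ _
    intro j hj
    rw [hact]
    push_cast
    have h1 := hstep n
    rcases hj.eq_or_lt with rfl | hj
    · have h2 := ih n le_rfl
      have h3 := norm_add_le (y (n + 1) - y n) (y n - y 0)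
      rw [sub_add_sub_cancel] at h3
      linarith
    · linarith [ih j (by omega), norm_nonneg (y (n + 1) - y n)]

theorem tendsto_variedAction (hS : IsGeneratingFunction S) (y : ℕ → Euc d) :
    Tendsto (variedAction S n y) (cocompact (Variation d n)) atTop := by
  obtain ⟨K, hK⟩ := hS.norm_sub_le_action
  rw [← Metric.cobounded_eq_cocompact, tendsto_atTop]
  intro M
  set D := ∑ k ∈ Finset.range (n + 1), ‖y k - y 0‖ with hD
  have hbd : Bornology.IsBounded {c : Variation d n | ¬ M ≤ variedAction S n y c} := by
    refine (Metric.isBounded_closedBall (x := (0 : Variation d n))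
      (r := √(n * (M + n * K + D) ^ 2))).subset ?_
    intro c hc
    rw [Set.mem_ofPred_eq, not_le] at hc
    rw [mem_closedBall_zero_iff]
    apply Real.le_sqrt_of_sq_le
    apply norm_sq_le
    intro k _ hk
    have h1 := hK n (fun k => y k + coord k c) k hk.le
    have h2 : ‖y k - y 0‖ ≤ D := Finset.single_le_sum (f := fun k => ‖y k - y 0‖)
      (fun _ _ => norm_nonneg _) (Finset.mem_range.mpr (by omega))
    have h3 : coord k c = (y k + coord k c - (y 0 + coord 0 c)) - (y k - y 0) := by
      rw [coord_zero]; abel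
    rw [h3]
    refine (norm_sub_le _ _).trans ?_
    change variedAction S n y c < M at hc
    rw [variedAction] at hc
    linarith
  have h2 := Bornology.isBounded_def.mp hbd
  filter_upwards [h2] with c hc
  exact not_not.mp hc

theorem exists_forall_variedAction_le (hS : IsGeneratingFunction S) (n : ℕ) (y : ℕ → Euc d) :
    ∃ c : Variation d n, ∀ c', variedAction S n y c ≤ variedAction S n y c' :=
  Continuous.exists_forall_le
    (continuous_iff_continuousAt.mpr fun c => (hS.hasFDerivAt_variedAction y c).continuousAt)
    (hS.tendsto_variedAction y)

/-- At a minimum of the action the second variation is nonnegative. -/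
theorem secondVariation_nonneg_of_forall_le (hS : IsGeneratingFunction S) {y : ℕ → Euc d}
    {c : Variation d n} (hc : ∀ c', variedAction S n y c ≤ variedAction S n y c')
    (ξ : Variation d n) : 0 ≤ secondVariation S n (fun k => y k + coord k c) ξ ξ := by
  have hcrit : firstVariation S n y c = 0 :=
    IsLocalMin.hasFDerivAt_eq_zero (Eventually.of_forall hc) (hS.hasFDerivAt_variedAction y c)
  by_contra! hneg
  have hline : ∀ t : ℝ, HasDerivAt (fun t : ℝ => c + t • ξ) ξ t := fun t => by
    simpa using ((hasDerivAt_id t).smul_const ξ).const_add c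
  set φ : ℝ → ℝ := fun t => variedAction S n y (c + t • ξ)
  have h1 : ∀ t, HasDerivAt φ (firstVariation S n y (c + t • ξ) ξ) t := fun t =>
    (hS.hasFDerivAt_variedAction y _).comp_hasDerivAt t (hline t)
  have h2 : HasDerivAt (fun t : ℝ => firstVariation S n y (c + t • ξ) ξ)
      (secondVariation S n (fun k => y k + coord k c) ξ ξ) 0 := by
    have h3 := HasFDerivAt.comp_hasDerivAt (l := firstVariation S n y) (0 : ℝ)
      ((hS.contDiff_firstVariation y).differentiable one_ne_zero _).hasFDerivAt (hline 0)
    have h4 := h3.clm_apply (hasDerivAt_const (0 : ℝ) ξ)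
    simp only [Function.comp_apply, zero_smul, add_zero, map_zero] at h4
    rw [hS.fderiv_firstVariation] at h4
    exact h4
  have hderiv : deriv φ = fun t : ℝ => firstVariation S n y (c + t • ξ) ξ :=
    funext fun t => (h1 t).deriv
  -- A negative second derivative would make `0` a local maximum of `φ` besides a minimum, so `φ`
  -- would be locally constant with zero second derivative.
  have hmax : IsLocalMax φ 0 := isLocalMax_of_deriv_deriv_neg
    (by rw [hderiv, h2.deriv]; exact hneg) (by rw [hderiv]; simp [hcrit])
    (h1 0).continuousAt
  have hmin : ∀ t, φ 0 ≤ φ t := fun t => by simpa [φ] using hc (c + t • ξ)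
  have hconst : φ =ᶠ[𝓝 0] fun _ => φ 0 := by
    filter_upwards [hmax] with t ht
    exact le_antisymm ht (hmin t)
  have h5 : deriv (deriv φ) 0 = 0 := by
    rw [hconst.deriv.deriv_eq]
    simp
  rw [hderiv, h2.deriv] at h5
  exact hneg.ne h5

/-! ### Orbits of the twist map -/

/-- The projection to `ℝ^d` of the orbit of `z`. -/
def orbit (hS : IsGeneratingFunction S) (z : CotangentEuc d) (k : ℕ) : Euc d :=
  ((hS.twistLift ^ k) z).1

theorem twistLift_pow_eq_ofPair (hS : IsGeneratingFunction S) (z : CotangentEuc d) (k : ℕ) :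
    (hS.twistLift ^ k) z = hS.ofPair (hS.orbit z k, hS.orbit z (k + 1)) := by
  obtain ⟨⟨x, y⟩, hq⟩ := hS.ofPair.surjective ((hS.twistLift ^ k) z)
  have h1 : hS.orbit z k = x := by rw [orbit, ← hq]; rfl
  have h2 : hS.orbit z (k + 1) = y := by
    rw [orbit, pow_succ', Equiv.Perm.mul_apply, ← hq, hS.twistLift_ofPair]
  rw [h1, h2, hq]

theorem twistLift_pow_snd (hS : IsGeneratingFunction S) (z : CotangentEuc d) (k : ℕ) :
    ((hS.twistLift ^ k) z).2 = -d1 S (hS.orbit z k) (hS.orbit z (k + 1)) := by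
  rw [twistLift_pow_eq_ofPair]; rfl

theorem twistLift_pow_succ_snd (hS : IsGeneratingFunction S) (z : CotangentEuc d) (k : ℕ) :
    ((hS.twistLift ^ (k + 1)) z).2 = d2 S (hS.orbit z k) (hS.orbit z (k + 1)) := by
  rw [pow_succ', Equiv.Perm.mul_apply, twistLift_pow_eq_ofPair, twistLift_ofPair]

theorem orbit_zero (hS : IsGeneratingFunction S) (z : CotangentEuc d) : hS.orbit z 0 = z.1 := rfl

theorem eq_ofPair_orbit (hS : IsGeneratingFunction S) (z : CotangentEuc d) :
    z = hS.ofPair (hS.orbit z 0, hS.orbit z 1) :=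
  hS.twistLift_pow_eq_ofPair z 0

theorem d2_add_d1_orbit (hS : IsGeneratingFunction S) (z : CotangentEuc d) (k : ℕ) :
    d2 S (hS.orbit z k) (hS.orbit z (k + 1)) +
      d1 S (hS.orbit z (k + 1)) (hS.orbit z (k + 2)) = 0 := by
  rw [← twistLift_pow_succ_snd, twistLift_pow_snd, neg_add_cancel]

/-- A segment that satisfies the discrete Euler-Lagrange equation is a segment of an orbit. -/
theorem orbit_ofPair_eq (hS : IsGeneratingFunction S) {y : ℕ → Euc d}
    (hy : ∀ k, k + 1 < n → d2 S (y k) (y (k + 1)) + d1 S (y (k + 1)) (y (k + 2)) = 0) :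
    ∀ k ≤ n, hS.orbit (hS.ofPair (y 0, y 1)) k = y k := by
  set z := hS.ofPair (y 0, y 1)
  have h : ∀ k < n, (hS.twistLift ^ k) z = hS.ofPair (y k, y (k + 1)) := by
    intro k hk
    induction k with
    | zero => rfl
    | succ k ih =>
      rw [pow_succ', Equiv.Perm.mul_apply, ih (by omega), twistLift_ofPair]
      exact Prod.ext rfl (eq_neg_of_add_eq_zero_left (hy k hk))
  intro k hk
  rcases k with - | k
  · rfl
  · rw [orbit, pow_succ', Equiv.Perm.mul_apply, h k (by omega), twistLift_ofPair]

theorem orbit_add_intVec (hS : IsGeneratingFunction S) (z : CotangentEuc d) (r : Fin d → ℤ)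
    (k : ℕ) : hS.orbit (z + (intVec r, 0)) k = hS.orbit z k + intVec r := by
  rw [orbit, twistLift_pow_add]; rfl

theorem contDiff_orbit (hS : IsGeneratingFunction S) (k : ℕ) :
    ContDiff ℝ 1 (fun z => hS.orbit z k) :=
  contDiff_fst.comp (hS.contDiff_twistLift_pow k)

/-! ### The second variation along orbits -/

theorem secondVariation_add_smul (hS : IsGeneratingFunction S) (y : ℕ → Euc d)
    (ξ η : Variation d n) (t : ℝ) :
    secondVariation S n y (ξ + t • η) (ξ + t • η) = secondVariation S n y ξ ξ +
      2 * t * secondVariation S n y ξ η + t ^ 2 * secondVariation S n y η η := by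
  have h := hS.secondVariation_symm y η ξ
  have h1 : secondVariation S n y (ξ + t • η) (ξ + t • η) = secondVariation S n y ξ ξ +
      t * secondVariation S n y ξ η + t * secondVariation S n y η ξ +
      t ^ 2 * secondVariation S n y η η := by
    simp only [secondVariation, Finset.mul_sum, ← Finset.sum_add_distrib]
    refine Finset.sum_congr rfl fun k _ => ?_
    have h2 : ∀ j, coord j (ξ + t • η) = coord j ξ + t • coord j η := fun j => by
      rw [map_add, map_smul]
    simp only [h2, ← Prod.mk_add_mk, ← Prod.smul_mk, map_add, map_smul, _root_.add_apply,
      _root_.smul_apply, smul_eq_mul]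
    ring
  rw [h1, h]
  ring

/-- Without conjugate points, the second variation along an orbit is nondegenerate. -/
theorem eq_zero_of_secondVariation_eq_zero {hS : IsGeneratingFunction S}
    (hF : hS.NoConjugatePoints) (z : CotangentEuc d) {ξ : Variation d n}
    (h : ∀ η, secondVariation S n (hS.orbit z) ξ η = 0) : ξ = 0 := by
  rcases Nat.eq_zero_or_pos n with rfl | hn
  · exact eq_zero_of_coord fun k _ hk => absurd hk (Nat.not_lt_zero k)
  set q : ℕ → Euc d × Euc d := fun k => (hS.orbit z k, hS.orbit z (k + 1))
  set v : ℕ → Euc d × Euc d := fun k => (coord k ξ, coord (k + 1) ξ)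
  -- Summation by parts turns membership in the kernel into the Jacobi equation, the linearized
  -- Euler-Lagrange equation.
  have hjac := (sum_coord_eq_zero_iff fun k => fderiv ℝ (fderiv ℝ S) (q k) (v k)).mp h
  -- The Jacobi field `ξ` starts at zero, so its initial tangent vector is the vertical vector `(0,
  -- η)`; the iterated differential then carries it along `ξ`.
  set η : Dual d := -fderiv ℝ (fun q : Euc d × Euc d => d1 S q.1 q.2) (q 0) (v 0)
  have hstep : ∀ k < n, fderiv ℝ (hS.twistLift ^ k : Equiv.Perm (CotangentEuc d)) z (0, η) =
      fderiv ℝ hS.ofPair (q k) (v k) := by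
    intro k hk
    induction k with
    | zero =>
      rw [pow_zero, Equiv.Perm.coe_one, fderiv_id, hS.fderiv_ofPair]
      exact Prod.ext (coord_zero ξ).symm rfl
    | succ k ih =>
      rw [fderiv_twistLift_pow_succ, ih (by omega), twistLift_pow_eq_ofPair,
        fderiv_twistLift_ofPair, fderiv_ofPair]
      refine Prod.ext rfl (ContinuousLinearMap.ext fun w => ?_)
      have h1 := hjac k hk w
      rw [← hS.fderiv_d1_uncurry_apply, ← hS.fderiv_d2_uncurry_apply] at h1
      exact eq_neg_of_add_eq_zero_left h1
  -- Since `ξ` also vanishes at time `n`, the image of `(0, η)` is vertical.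
  have hη : η = 0 := by
    obtain ⟨m, rfl⟩ : ∃ m, n = m + 1 := ⟨n - 1, by omega⟩
    refine hF.lift z (n := m + 1) m.succ_ne_zero ?_
    rw [fderiv_twistLift_pow_succ, hstep m (by omega), twistLift_pow_eq_ofPair,
      fderiv_twistLift_ofPair]
    exact coord_last ξ
  refine eq_zero_of_coord fun k _ hk => ?_
  have h1 := hstep k hk
  rw [hη, Prod.mk_zero_zero, map_zero, fderiv_ofPair] at h1
  exact (Prod.mk_eq_zero.mp h1.symm).1

theorem continuous_secondVariation_orbit (hS : IsGeneratingFunction S) :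
    Continuous fun p : CotangentEuc d × Variation d n =>
      secondVariation S n (hS.orbit p.1) p.2 p.2 := by
  refine continuous_finsetSum _ fun k _ => ?_
  have h1 : Continuous fun p : CotangentEuc d × Variation d n =>
      fderiv ℝ (fderiv ℝ S) (hS.orbit p.1 k, hS.orbit p.1 (k + 1)) :=
    (hS.contDiff_fderiv.continuous_fderiv one_ne_zero).comp
      (((hS.contDiff_orbit k).continuous.comp continuous_fst).prodMk
        ((hS.contDiff_orbit (k + 1)).continuous.comp continuous_fst))
  have h2 : Continuous fun p : CotangentEuc d × Variation d n =>
      (coord k p.2, coord (k + 1) p.2) := by fun_prop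
  exact (h1.clm_apply h2).clm_apply h2

/-- An isotropic vector of a nonnegative form lies in its kernel, which is trivial here. -/
theorem secondVariation_pos_of_nonneg {hS : IsGeneratingFunction S}
    (hF : hS.NoConjugatePoints) (z : CotangentEuc d)
    (h : ∀ ξ : Variation d n, 0 ≤ secondVariation S n (hS.orbit z) ξ ξ) {ξ : Variation d n}
    (hξ : ξ ≠ 0) : 0 < secondVariation S n (hS.orbit z) ξ ξ := by
  refine (h ξ).lt_of_ne' fun h0 => hξ (eq_zero_of_secondVariation_eq_zero hF z fun η => ?_)
  set a := secondVariation S n (hS.orbit z) η η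
  set b := secondVariation S n (hS.orbit z) ξ η
  have hq : ∀ t : ℝ, 0 ≤ 2 * t * b + t ^ 2 * a := fun t => by
    have h1 := h (ξ + t • η)
    rwa [hS.secondVariation_add_smul, h0, zero_add] at h1
  have ha : 0 ≤ a := h η
  -- A nearly optimal `t`; the denominator `a + 1` avoids a separate case `a = 0`.
  have h2 := hq (-b / (a + 1))
  have h3 : 2 * (-b / (a + 1)) * b + (-b / (a + 1)) ^ 2 * a = -(b ^ 2 * (a + 2)) / (a + 1) ^ 2 := by
    field_simp
    ring
  rw [h3, le_div_iff₀ (by positivity)] at h2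
  have h4 : b ^ 2 ≤ 0 := by nlinarith [sq_nonneg b]
  exact pow_eq_zero_iff two_ne_zero |>.mp (le_antisymm h4 (sq_nonneg b))

/-- Coercivity provides a minimizer among the segments with the endpoints of `y`, and its
Euler-Lagrange equation makes it an orbit segment. -/
theorem exists_orbit_minimizer (hS : IsGeneratingFunction S) (y : ℕ → Euc d) :
    ∃ (z : CotangentEuc d) (c : Variation d n),
      (∀ c', variedAction S n y c ≤ variedAction S n y c') ∧
      ∀ k ≤ n, hS.orbit z k = y k + coord k c := by
  obtain ⟨c, hc⟩ := hS.exists_forall_variedAction_le n y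
  have hcrit : firstVariation S n y c = 0 :=
    IsLocalMin.hasFDerivAt_eq_zero (Eventually.of_forall hc) (hS.hasFDerivAt_variedAction y c)
  exact ⟨_, c, hc, hS.orbit_ofPair_eq ((hS.firstVariation_eq_zero_iff y c).mp hcrit)⟩

/-- Without conjugate points, the second variation along an orbit is positive definite. -/
theorem secondVariation_orbit_pos {hS : IsGeneratingFunction S} (hF : hS.NoConjugatePoints)
    (z : CotangentEuc d) {ξ : Variation d n} (hξ : ξ ≠ 0) :
    0 < secondVariation S n (hS.orbit z) ξ ξ := by
  set Z : Set (CotangentEuc d) :=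
    {z | ∀ ξ : Variation d n, 0 ≤ secondVariation S n (hS.orbit z) ξ ξ} with hZ
  have hcont := hS.continuous_secondVariation_orbit (n := n)
  have hclosed : IsClosed Z := by
    rw [hZ, Set.ofPred_forall]
    exact isClosed_iInter fun ξ => isClosed_le continuous_const
      (hcont.comp (continuous_id.prodMk continuous_const))
  -- On `Z` the form is positive definite; by compactness of the unit sphere it remains so at nearby
  -- initial points.
  have hopen : IsOpen Z := by
    rw [isOpen_iff_mem_nhds]
    intro z hz
    have h1 : ∀ᶠ z' in 𝓝 z, ∀ ξ ∈ Metric.sphere (0 : Variation d n) 1,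
        0 < secondVariation S n (hS.orbit z') ξ ξ :=
      (isCompact_sphere _ _).eventually_forall_of_forall_eventually fun ξ hξ =>
        hcont.continuousAt.eventually (lt_mem_nhds
          (secondVariation_pos_of_nonneg hF z hz (ne_zero_of_mem_unit_sphere ⟨ξ, hξ⟩)))
    filter_upwards [h1] with z' hz' ξ
    rcases eq_or_ne ξ 0 with rfl | hξ
    · simpa using (secondVariation_smul (hS.orbit z') (0 : Variation d n) 0).ge
    · have h2 := hz' (‖ξ‖⁻¹ • ξ) (by simp [norm_smul, hξ])
      rw [secondVariation_smul] at h2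
      exact (pos_of_mul_pos_right h2 (by positivity)).le
  have hne : Z.Nonempty := by
    obtain ⟨z, c, hc, hzc⟩ := hS.exists_orbit_minimizer (n := n) (fun _ => 0)
    refine ⟨z, fun ξ => ?_⟩
    rw [secondVariation_congr hzc]
    exact hS.secondVariation_nonneg_of_forall_le hc ξ
  have huniv : Z = Set.univ := IsClopen.eq_univ ⟨hclosed, hopen⟩ hne
  exact secondVariation_pos_of_nonneg hF z (huniv ▸ Set.mem_univ z : z ∈ Z) hξ

/-! ### Orbits minimize the action -/

/-- Without conjugate points, the action has at most one critical point among the segments with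
prescribed endpoints. -/
theorem eq_of_firstVariation_eq_zero {hS : IsGeneratingFunction S} (hF : hS.NoConjugatePoints)
    (y : ℕ → Euc d) {c₁ c₂ : Variation d n} (h₁ : firstVariation S n y c₁ = 0)
    (h₂ : firstVariation S n y c₂ = 0) : c₁ = c₂ := by
  set D := InnerProductSpace.toDual ℝ (Variation d n)
  set g : Variation d n → Variation d n := fun c => D.symm (firstVariation S n y c)
  have hg : ∀ c, innerSL ℝ (g c) = firstVariation S n y c := fun c => D.apply_symm_apply _
  have hinner : ∀ c ξ, inner ℝ (g c) ξ = firstVariation S n y c ξ := fun c ξ =>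
    DFunLike.congr_fun (hg c) ξ
  have hzero : ∀ c, g c = 0 ↔ firstVariation S n y c = 0 := fun c => by
    simp [g]
  have hD : IsBoundedLinearMap ℝ D.symm :=
    ⟨⟨map_add D.symm, fun t f => by simp⟩, 1, one_pos, fun f => by simp⟩
  have hgC : ContDiff ℝ 1 g := hD.contDiff.comp (hS.contDiff_firstVariation y)
  refine eq_of_gradient_eq_zero (W := variedAction S n y) (g := g)
    (fun c => by rw [hg]; exact hS.hasFDerivAt_variedAction y c) hgC
    (hS.tendsto_variedAction y) (fun c hc => ?_) ((hzero _).mpr h₁) ((hzero _).mpr h₂)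
  have hcrit := (hzero c).mp hc
  have horb := hS.orbit_ofPair_eq ((hS.firstVariation_eq_zero_iff y c).mp hcrit)
  set z := hS.ofPair _
  have hpd : ∀ ξ : Variation d n, ξ ≠ 0 → 0 < fderiv ℝ (firstVariation S n y) c ξ ξ := by
    intro ξ hξ
    rw [hS.fderiv_firstVariation, ← secondVariation_congr horb]
    exact secondVariation_orbit_pos hF z hξ
  -- The Hessian stays positive definite near `c`, so by the mean value theorem the gradient has
  -- positive inner product with `x - c` for `x ≠ c` close to `c`.
  have hev : ∀ᶠ x in 𝓝 c, ∀ ξ ∈ Metric.sphere (0 : Variation d n) 1,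
      0 < fderiv ℝ (firstVariation S n y) x ξ ξ := by
    refine (isCompact_sphere _ _).eventually_forall_of_forall_eventually fun ξ hξ => ?_
    have hcont : Continuous fun p : Variation d n × Variation d n =>
        fderiv ℝ (firstVariation S n y) p.1 p.2 p.2 :=
      ((((hS.contDiff_firstVariation y).continuous_fderiv one_ne_zero).comp
        continuous_fst).clm_apply continuous_snd).clm_apply continuous_snd
    exact hcont.continuousAt.eventually
      (lt_mem_nhds (hpd ξ (ne_zero_of_mem_unit_sphere ⟨ξ, hξ⟩)))
  obtain ⟨ρ, hρ, hball⟩ := Metric.nhds_basis_closedBall.mem_iff.mp hev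
  refine ⟨ρ, hρ, fun x hx hxc => ?_⟩
  rw [hinner]
  have hline : ∀ t : ℝ, HasDerivAt (fun t : ℝ => c + t • (x - c)) (x - c) t := fun t => by
    simpa using ((hasDerivAt_id t).smul_const (x - c)).const_add c
  have hder : ∀ t : ℝ, HasDerivAt (fun t : ℝ => firstVariation S n y (c + t • (x - c)) (x - c))
      (fderiv ℝ (firstVariation S n y) (c + t • (x - c)) (x - c) (x - c)) t := by
    intro t
    have h3 := HasFDerivAt.comp_hasDerivAt (l := firstVariation S n y) t
      ((hS.contDiff_firstVariation y).differentiable one_ne_zero _).hasFDerivAt (hline t)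
    simpa using h3.clm_apply (hasDerivAt_const t (x - c))
  obtain ⟨t, ⟨ht0, ht1⟩, ht⟩ := exists_hasDerivAt_eq_slope _ _ (zero_lt_one (α := ℝ))
    (fun t _ => (hder t).continuousAt.continuousWithinAt) (fun t _ => hder t)
  simp only [one_smul, add_sub_cancel, zero_smul, add_zero, sub_zero, div_one, hcrit,
    _root_.zero_apply] at ht
  rw [← ht]
  have hxc' : x - c ≠ 0 := sub_ne_zero.mpr hxc
  have hmem : c + t • (x - c) ∈ Metric.closedBall c ρ := by
    rw [mem_closedBall_iff_norm] at hx ⊢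
    rw [add_sub_cancel_left, norm_smul, Real.norm_of_nonneg ht0.le]
    nlinarith [norm_nonneg (x - c)]
  have h3 := hball hmem (‖x - c‖⁻¹ • (x - c)) (by simp [norm_smul, hxc'])
  rw [map_smul, map_smul, _root_.smul_apply, smul_smul, smul_eq_mul] at h3
  exact pos_of_mul_pos_right h3 (by positivity)

theorem firstVariation_orbit (hS : IsGeneratingFunction S) (z : CotangentEuc d) :
    firstVariation S n (hS.orbit z) 0 = 0 := by
  rw [hS.firstVariation_eq_zero_iff]
  intro k _
  simpa using hS.d2_add_d1_orbit z k

/-- Without conjugate points, an orbit minimizes the action between any two of its points. -/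
theorem action_orbit_le {hS : IsGeneratingFunction S} (hF : hS.NoConjugatePoints)
    (z : CotangentEuc d) {y : ℕ → Euc d} (h0 : y 0 = hS.orbit z 0) (hn : y n = hS.orbit z n) :
    action S n (hS.orbit z) ≤ action S n y := by
  obtain ⟨c, hc⟩ := hS.exists_forall_variedAction_le n (hS.orbit z)
  have hcrit : firstVariation S n (hS.orbit z) c = 0 :=
    IsLocalMin.hasFDerivAt_eq_zero (Eventually.of_forall hc) (hS.hasFDerivAt_variedAction _ c)
  -- The minimizer and the orbit itself are both critical, hence equal.
  obtain rfl := eq_of_firstVariation_eq_zero hF _ hcrit (hS.firstVariation_orbit z)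
  obtain ⟨c', hc'⟩ := exists_coord_eq (n := n) (fun k => y k - hS.orbit z k)
    (sub_eq_zero.mpr h0) (sub_eq_zero.mpr hn)
  have h1 := hc c'
  have h2 : variedAction S n (hS.orbit z) 0 = action S n (hS.orbit z) := by
    simp [variedAction]
  have h3 : variedAction S n (hS.orbit z) c' = action S n y :=
    action_congr fun k hk => by rw [hc' k hk, add_sub_cancel]
  rwa [h2, h3] at h1

/-- Without conjugate points, a point and its fibre coordinate are determined by the endpoints of
an orbit segment, which are arbitrary. -/
theorem bijective_endpoints {hS : IsGeneratingFunction S} (hF : hS.NoConjugatePoints)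
    (hn : 1 ≤ n) : Function.Bijective fun z => (hS.orbit z 0, hS.orbit z n) := by
  constructor
  · intro z z' h
    obtain ⟨h0, h1⟩ := Prod.mk.inj h
    obtain ⟨c, hc⟩ := exists_coord_eq (n := n) (fun k => hS.orbit z' k - hS.orbit z k)
      (sub_eq_zero.mpr h0.symm) (sub_eq_zero.mpr h1.symm)
    have hc' : ∀ k ≤ n, hS.orbit z k + coord k c = hS.orbit z' k := fun k hk => by
      rw [hc k hk, add_sub_cancel]
    have hcrit : firstVariation S n (hS.orbit z) c = 0 := by
      rw [hS.firstVariation_eq_zero_iff]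
      intro k hk
      rw [hc' k (by omega), hc' (k + 1) (by omega), hc' (k + 2) (by omega)]
      exact hS.d2_add_d1_orbit z' k
    obtain rfl := eq_of_firstVariation_eq_zero hF _ hcrit (hS.firstVariation_orbit z)
    have h2 := hc' 1 hn
    rw [map_zero, add_zero] at h2
    rw [hS.eq_ofPair_orbit z, hS.eq_ofPair_orbit z', h0, h2]
  · rintro ⟨a, b⟩
    obtain ⟨z, c, -, hz⟩ := hS.exists_orbit_minimizer (n := n) (fun k => if k = 0 then a else b)
    refine ⟨z, Prod.ext ?_ ?_⟩
    · simpa using hz 0 (Nat.zero_le n)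
    · have := hz n le_rfl
      simpa [show n ≠ 0 by omega] using this

/-! ### Orbits that are periodic up to a translation -/

section Periodic

variable {hS : IsGeneratingFunction S} {N : ℕ} {r : Fin d → ℤ} {z z' : CotangentEuc d}

theorem twistLift_pow_mul_eq (hz : (hS.twistLift ^ N) z = z + (intVec r, 0)) (k : ℕ) :
    (hS.twistLift ^ (N * k)) z = z + (intVec (k • r), 0) := by
  induction k with
  | zero => simp
  | succ k ih =>
    rw [mul_add_one, pow_add, Equiv.Perm.mul_apply, hz, twistLift_pow_add, ih, add_assoc,
      succ_nsmul, map_add]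
    exact congrArg (z + ·) (Prod.ext rfl (add_zero 0))

theorem orbit_mul_add (hz : (hS.twistLift ^ N) z = z + (intVec r, 0)) (k j : ℕ) :
    hS.orbit z (N * k + j) = hS.orbit z j + intVec (k • r) := by
  rw [orbit, add_comm, pow_add, Equiv.Perm.mul_apply, twistLift_pow_mul_eq hz, twistLift_pow_add]
  rfl

theorem action_mul (hz : (hS.twistLift ^ N) z = z + (intVec r, 0)) (k : ℕ) :
    action S (N * k) (hS.orbit z) = k * action S N (hS.orbit z) := by
  induction k with
  | zero => simp [action]
  | succ k ih =>
    rw [action] at ih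
    rw [mul_add_one, action, Finset.sum_range_add, ih]
    simp only [add_assoc, orbit_mul_add hz, hS.periodic]
    rw [← action]
    push_cast
    ring

/-- Two minimizing orbits that are periodic up to the same translation have the same action. -/
theorem action_le_of_periodic (hF : hS.NoConjugatePoints) (hN : 1 ≤ N)
    (hz : (hS.twistLift ^ N) z = z + (intVec r, 0))
    (hz' : (hS.twistLift ^ N) z' = z' + (intVec r, 0)) :
    action S N (hS.orbit z) ≤ action S N (hS.orbit z') := by
  obtain ⟨M, rfl⟩ : ∃ M, N = M + 1 := ⟨N - 1, by omega⟩
  set x := hS.orbit z with hx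
  set x' := hS.orbit z' with hx'
  -- The cost of replacing the two endpoints of a long segment of `x'` by those of `x`; by
  -- periodicity it does not depend on the length.
  set C := S (x 0, x' 1) - S (x' 0, x' 1) + (S (x' M, x 0 + intVec r) - S (x' M, x' 0 + intVec r))
  have key : ∀ l : ℕ, ((l + 2 : ℕ) : ℝ) * action S (M + 1) x ≤
      ((l + 2 : ℕ) : ℝ) * action S (M + 1) x' + C := by
    intro l
    rw [← action_mul hz, ← action_mul hz']
    -- At least two periods are taken, so that the first and the last steps are distinct even when
    -- the period is `1`.
    obtain ⟨p, hp⟩ : ∃ p, (M + 1) * (l + 2) = p + 2 := ⟨(M + 1) * (l + 2) - 2, by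
      have := Nat.mul_le_mul (Nat.le_add_left 1 M) (Nat.le_add_left 2 l)
      omega⟩
    have hp' : p + 1 = (M + 1) * (l + 1) + M := by
      have : (M + 1) * (l + 2) = (M + 1) * (l + 1) + (M + 1) := by ring
      omega
    have hlast : ∀ w, (hS.twistLift ^ (M + 1)) w = w + (intVec r, 0) →
        hS.orbit w (p + 2) = hS.orbit w 0 + intVec r + intVec ((l + 1) • r) := by
      intro w hw
      have h1 := orbit_mul_add hw (l + 2) 0
      rw [add_zero, hp] at h1
      rw [h1, succ_nsmul', map_add, add_assoc]
    have hprev : x' (p + 1) = x' M + intVec ((l + 1) • r) := by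
      rw [hp', hx', orbit_mul_add hz']
    -- The competitor follows `x'` except at its two ends, which are those of `x`.
    set y : ℕ → Euc d := fun j => if j = 0 then x 0 else if j = p + 2 then x (p + 2) else x' j
    have hle := action_orbit_le (n := p + 2) hF z (y := y) (by simp [y, hx]) (by simp [y, hx])
    have hsplit : ∀ u : ℕ → Euc d, action S (p + 2) u =
        ∑ j ∈ Finset.range p, S (u (j + 1), u (j + 2)) + S (u 0, u 1) +
          S (u (p + 1), u (p + 2)) := fun u => by
      rw [action, Finset.sum_range_succ, Finset.sum_range_succ']
    have hmid : ∑ j ∈ Finset.range p, S (y (j + 1), y (j + 2)) =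
        ∑ j ∈ Finset.range p, S (x' (j + 1), x' (j + 2)) := by
      refine Finset.sum_congr rfl fun j hj => ?_
      rw [Finset.mem_range] at hj
      simp only [y]
      rw [if_neg (by omega), if_neg (by omega), if_neg (by omega), if_neg (by omega)]
    have hy0 : y 0 = x 0 := by simp [y]
    have hy1 : y 1 = x' 1 := by simp [y]
    have hyp : y (p + 1) = x' (p + 1) := by simp [y]
    have hyl : y (p + 2) = x (p + 2) := by simp [y]
    rw [hsplit y, hmid, hy0, hy1, hyp, hyl, hprev, hx, hlast z hz, hS.periodic] at hle
    rw [hp, hsplit x', hprev, hx', hlast z' hz', hS.periodic]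
    simp only [C]
    linarith
  by_contra! hlt
  -- A strict inequality between the actions would grow linearly in `l` and exceed the fixed error
  -- `C`.
  obtain ⟨l, hl⟩ := exists_nat_gt (C / (action S (M + 1) x - action S (M + 1) x'))
  rw [div_lt_iff₀ (by linarith)] at hl
  have h1 := key l
  push_cast at h1
  nlinarith

end Periodic

/-! ### The action of loops -/

/-- This is the exactness of the twist map: the differential of the action is the pullback of the
Liouville form `p dx` minus the form itself. The sum telescopes because one more step adds `-p_n
dx_n + p_{n+1} dx_{n+1}`. -/
theorem hasFDerivAt_action_orbit (hS : IsGeneratingFunction S) (n : ℕ) (z : CotangentEuc d) :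
    HasFDerivAt (fun z => action S n (hS.orbit z))
      (((hS.twistLift ^ n) z).2.comp ((ContinuousLinearMap.fst ℝ (Euc d) (Dual d)).comp
          (fderiv ℝ (hS.twistLift ^ n : Equiv.Perm (CotangentEuc d)) z)) -
        z.2.comp (ContinuousLinearMap.fst ℝ (Euc d) (Dual d))) z := by
  induction n with
  | zero =>
    have h : (fun z => action S 0 (hS.orbit z)) = fun _ => 0 := by
      funext z; simp [action]
    rw [h]
    refine (hasFDerivAt_const (0 : ℝ) z).congr_fderiv ?_
    rw [pow_zero, Equiv.Perm.coe_one, fderiv_id]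
    exact ContinuousLinearMap.ext fun ζ => (sub_self (z.2 ζ.1)).symm
  | succ n ih =>
    have h1 : ∀ k, HasFDerivAt (fun z => hS.orbit z k)
        ((ContinuousLinearMap.fst ℝ (Euc d) (Dual d)).comp
          (fderiv ℝ (hS.twistLift ^ k : Equiv.Perm (CotangentEuc d)) z)) z := fun k =>
      (ContinuousLinearMap.fst ℝ (Euc d) (Dual d)).hasFDerivAt.comp z
        ((hS.contDiff_twistLift_pow k).differentiable one_ne_zero z).hasFDerivAt
    have h2 := HasFDerivAt.comp (g := S) (f := fun z => (hS.orbit z n, hS.orbit z (n + 1))) z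
      (hS.contDiff.differentiable two_ne_zero _).hasFDerivAt ((h1 n).prodMk (h1 (n + 1)))
    have h3 : (fun z => action S (n + 1) (hS.orbit z)) = fun z =>
        action S n (hS.orbit z) + S (hS.orbit z n, hS.orbit z (n + 1)) := by
      funext z; exact Finset.sum_range_succ _ _
    rw [h3]
    refine (ih.add h2).congr_fderiv (ContinuousLinearMap.ext fun ζ => ?_)
    set v := (fderiv ℝ (hS.twistLift ^ n : Equiv.Perm (CotangentEuc d)) z ζ).1 with hv
    set w := (fderiv ℝ (hS.twistLift ^ (n + 1) : Equiv.Perm (CotangentEuc d)) z ζ).1 with hw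
    have h4 : fderiv ℝ S (hS.orbit z n, hS.orbit z (n + 1)) (v, w) =
        d1 S (hS.orbit z n) (hS.orbit z (n + 1)) v +
          d2 S (hS.orbit z n) (hS.orbit z (n + 1)) w := by
      rw [← hS.fderiv_apply_inl (hS.orbit z n, hS.orbit z (n + 1)),
        ← hS.fderiv_apply_inr (hS.orbit z n, hS.orbit z (n + 1)), ← map_add, Prod.mk_add_mk,
        add_zero, zero_add]
    change ((hS.twistLift ^ n) z).2 v - z.2 ζ.1 +
      fderiv ℝ S (hS.orbit z n, hS.orbit z (n + 1)) (v, w) =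
        ((hS.twistLift ^ (n + 1)) z).2 w - z.2 ζ.1
    rw [h4, twistLift_pow_snd, twistLift_pow_succ_snd, _root_.neg_apply]
    ring

/-- Without conjugate points, an orbit with `x_N = x_0 + r` is periodic up to the translation by
`r`. -/
theorem twistLift_pow_eq_add {hS : IsGeneratingFunction S} (hF : hS.NoConjugatePoints) {N : ℕ}
    (hN : 1 ≤ N) {r : Fin d → ℤ} {z : CotangentEuc d}
    (hz : hS.orbit z N = hS.orbit z 0 + intVec r) :
    (hS.twistLift ^ N) z = z + (intVec r, 0) := by
  set e : CotangentEuc d ≃ Euc d × Euc d := Equiv.ofBijective _ (bijective_endpoints hF hN)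
  have heC : ContDiff ℝ 1 e := (hS.contDiff_orbit 0).prodMk (hS.contDiff_orbit N)
  -- The kernel of the differential of `e` consists of vertical vectors sent to vertical vectors, so
  -- absence of conjugate points makes it trivial.
  have hesymm : ContDiff ℝ 1 e.symm := by
    refine contDiff_symm_of_injective_fderiv (by simp [finrank_dual]) e heC fun z => ?_
    have h1 : HasFDerivAt e ((ContinuousLinearMap.fst ℝ (Euc d) (Dual d)).prod
        ((ContinuousLinearMap.fst ℝ (Euc d) (Dual d)).comp
          (fderiv ℝ (hS.twistLift ^ N : Equiv.Perm (CotangentEuc d)) z))) z :=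
      (ContinuousLinearMap.fst ℝ (Euc d) (Dual d)).hasFDerivAt.prodMk
        ((ContinuousLinearMap.fst ℝ (Euc d) (Dual d)).hasFDerivAt.comp z
          ((hS.contDiff_twistLift_pow N).differentiable one_ne_zero z).hasFDerivAt)
    rw [h1.fderiv, injective_iff_map_eq_zero]
    rintro ⟨ξ, η⟩ h
    obtain ⟨h2, h3⟩ := Prod.mk_eq_zero.mp h
    obtain rfl : ξ = 0 := h2
    rw [hF.lift z (by omega) h3]
    rfl
  set loop : Euc d → CotangentEuc d := fun a => e.symm (a, a + intVec r) with hloop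
  have hel : ∀ a, (hS.orbit (loop a) 0, hS.orbit (loop a) N) = (a, a + intVec r) := fun a =>
    e.apply_symm_apply (a, a + intVec r)
  have hl0 : ∀ a, (loop a).1 = a := fun a => (Prod.mk.inj (hel a)).1
  have hlN : ∀ a, ((hS.twistLift ^ N) (loop a)).1 = a + intVec r := fun a => (Prod.mk.inj (hel a)).2
  have hloopC : ContDiff ℝ 1 loop :=
    hesymm.comp (contDiff_id.prodMk (contDiff_id.add contDiff_const))
  set f : Euc d → ℝ := fun a => action S N (hS.orbit (loop a)) with hf
  -- Both endpoints `a` and `a + r` move with velocity `v`, so the formula for the differential of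
  -- the action reduces to `(p_N - p_0) v`.
  have hfder : ∀ a, HasFDerivAt f (((hS.twistLift ^ N) (loop a)).2 - (loop a).2) a := by
    intro a
    have hL := (hloopC.differentiable one_ne_zero a).hasFDerivAt
    have h1 := ((ContinuousLinearMap.fst ℝ (Euc d) (Dual d)).hasFDerivAt.comp a hL)
    rw [show (ContinuousLinearMap.fst ℝ (Euc d) (Dual d)) ∘ loop = id from funext hl0] at h1
    have h2 := (ContinuousLinearMap.fst ℝ (Euc d) (Dual d)).hasFDerivAt.comp a
      (((hS.contDiff_twistLift_pow N).differentiable one_ne_zero (loop a)).hasFDerivAt.comp a hL)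
    rw [show (ContinuousLinearMap.fst ℝ (Euc d) (Dual d)) ∘
      ((hS.twistLift ^ N : Equiv.Perm (CotangentEuc d)) ∘ loop) = fun a => a + intVec r from
        funext hlN] at h2
    refine ((hS.hasFDerivAt_action_orbit N (loop a)).comp a hL).congr_fderiv ?_
    ext v
    have h3 := DFunLike.congr_fun (h1.unique (hasFDerivAt_id a)) v
    have h4 := DFunLike.congr_fun (h2.unique ((hasFDerivAt_id a).add_const _)) v
    change (fderiv ℝ loop a v).1 = v at h3
    change (fderiv ℝ (hS.twistLift ^ N : Equiv.Perm (CotangentEuc d)) (loop a)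
      (fderiv ℝ loop a v)).1 = v at h4
    change ((hS.twistLift ^ N) (loop a)).2 (fderiv ℝ (hS.twistLift ^ N :
      Equiv.Perm (CotangentEuc d)) (loop a) (fderiv ℝ loop a v)).1 -
        (loop a).2 (fderiv ℝ loop a v).1 = ((hS.twistLift ^ N) (loop a)).2 v - (loop a).2 v
    rw [h3, h4]
  have hper : ∀ a, ((hS.twistLift ^ N) (loop a)).2 - (loop a).2 = 0 →
      (hS.twistLift ^ N) (loop a) = loop a + (intVec r, 0) := fun a ha =>
    Prod.ext ((hlN a).trans (by rw [Prod.fst_add, hl0])) (by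
      rw [Prod.snd_add, add_zero]; exact sub_eq_zero.mp ha)
  -- By uniqueness of the segment with given endpoints, translating `a` by an integer vector
  -- translates the whole segment.
  have hfper : ∀ a (s : Fin d → ℤ), f (a + intVec s) = f a := by
    intro a s
    have h1 : loop (a + intVec s) = loop a + (intVec s, 0) := by
      rw [hloop, Equiv.symm_apply_eq]
      refine (Prod.ext ?_ ?_ : e (loop a + (intVec s, 0)) = _).symm
      · change hS.orbit (loop a + (intVec s, 0)) 0 = _
        rw [hS.orbit_add_intVec, orbit_zero, hl0]
      · change hS.orbit (loop a + (intVec s, 0)) N = _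
        rw [hS.orbit_add_intVec, orbit, hlN]
        exact add_right_comm _ _ _
    simp only [hf, h1, action, hS.orbit_add_intVec, hS.periodic]
  have hfC : Continuous f := continuous_iff_continuousAt.mpr fun a => (hfder a).continuousAt
  obtain ⟨a, ha⟩ := exists_forall_ge_of_periodic hfC hfper
  obtain ⟨b, hb⟩ := exists_forall_ge_of_periodic hfC.neg fun u s => congrArg Neg.neg (hfper u s)
  have hza := hper a (IsLocalMax.hasFDerivAt_eq_zero (Eventually.of_forall ha) (hfder a))
  have hzb := hper b (IsLocalMin.hasFDerivAt_eq_zero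
    (Eventually.of_forall fun u => neg_le_neg_iff.mp (hb u)) (hfder b))
  -- The maximum of `f` is at most its minimum: `f` is constant, and the base point of `z` is
  -- critical as well.
  have hab : f a ≤ f b := action_le_of_periodic hF hN hza hzb
  have hzl : z = loop z.1 := by
    rw [hloop, Equiv.eq_symm_apply]
    exact Prod.ext rfl hz
  rw [hzl]
  refine hper _ (IsLocalMax.hasFDerivAt_eq_zero (Eventually.of_forall fun u => ?_) (hfder _))
  exact (ha u).trans (hab.trans (neg_le_neg_iff.mp (hb _)))

end IsGeneratingFunction

end TwistMap

end

/-! ### Bi-infinite extremal sequences -/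

theorem proposition2p1 {d : ℕ} (hd : 1 ≤ d)
    (S : TwistMap.Euc d × TwistMap.Euc d → ℝ) (hS : TwistMap.IsGeneratingFunction S)
    (hF : hS.NoConjugatePoints)
    (r : Fin d → ℤ) (N : ℕ) (hN : 1 ≤ N)
    (x : ℤ → TwistMap.Euc d) (hx : TwistMap.IsExtremal S x)
    (hr : x N = x 0 + TwistMap.intVec r) :
    ∀ n : ℤ, x (n + N) = x n + TwistMap.intVec r := by
  set Z : ℤ → TwistMap.CotangentEuc d := fun n => hS.ofPair (x n, x (n + 1)) with hZ
  have hstep : ∀ n, hS.twistLift (Z n) = Z (n + 1) := by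
    intro n
    rw [hZ, hS.twistLift_ofPair]
    have h := hx (n + 1)
    rw [add_sub_cancel_right] at h
    exact Prod.ext rfl (eq_neg_of_add_eq_zero_left h)
  have hpow : ∀ k : ℕ, (hS.twistLift ^ k) (Z 0) = Z k := by
    intro k
    induction k with
    | zero => rfl
    | succ k ih => rw [pow_succ', Equiv.Perm.mul_apply, ih, hstep, Nat.cast_succ]
  have horb : hS.orbit (Z 0) N = hS.orbit (Z 0) 0 + TwistMap.intVec r := by
    rw [TwistMap.IsGeneratingFunction.orbit, hpow]
    exact hr
  have hper := TwistMap.IsGeneratingFunction.twistLift_pow_eq_add hF hN horb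
  rw [hpow] at hper
  -- The relation at time `0` propagates to all times because the lifted map commutes with integer
  -- translations, and backwards because it is injective.
  have hall : ∀ n : ℤ, Z (n + N) = Z n + (TwistMap.intVec r, 0) := by
    intro n
    induction n using Int.induction_on with
    | zero => rw [zero_add, hper]
    | succ n ih =>
      rw [add_right_comm, ← hstep, ih, hS.twistLift_add, hstep]
    | pred n ih =>
      apply hS.twistLift.injective
      rw [hS.twistLift_add, hstep, hstep, sub_add_cancel, ← ih]
      congr 1
      ring
  exact fun n => congrArg Prod.fst (hall n)
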